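/- Let $p,k\ge 1$ be integers and $m>0$. Let $X\sim N_p(\theta,\sigma^2 I_p)$ and $S^2\sim\sigma^2\chi^2_k$ be independent, where $(\theta,\sigma)$ is known to lie in $$\Theta(m)=\{(\theta,\sigma)\in\mathbb R^p\times(0,\infty):\ \|\theta\|/\sigma\le m\}.$$ The risk of an estimator $\delta=\delta(X,S^2)$ of $\theta$ is $R((\theta,\sigma),\delta)=\sigma^{-2}\,E_{\theta,\sigma}\|\delta(X,S^2)-\theta\|^2\in[0,\infty]$. An estimator $\delta_2$ *dominates* $\delta_1$ if $R((\theta,\sigma),\delta_2)\le R((\theta,\sigma),\delta_1)$ for all $(\theta,\sigma)\in\Theta(m)$, with strict inequality for at least one $(\theta,\sigma)\in\Theta(m)$; $\delta_1$ is *inadmissible* if some (measurable) estimator dominates it. For $h:\mathbb R\to\mathbb R$ write $\delta_h(X,S^2)=h(T)\,X$ with $T=\|X\|^2/S^2$. * The maximum likelihood estimator $\delta_{\rm mle}$ is the $\theta$-component of a maximizer over $\Theta(m)$ of the likelihood of $(\theta,\sigma)$ based on $(X,S^2)$. * For real $l<k+p$, the boundary uniform estimator $\delta_{BU,l}$ is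 the generalized Bayes estimator (minimizer of the posterior expected loss, for the loss $\|d-\theta\|^2/\sigma^2$) for the improper prior under which $\sigma^2$ has density $(\sigma^2)^{l/2-1}$ on $(0,\infty)$ and, given $\sigma^2$, $\theta$ is uniform on the sphere of radius $m\sigma$ centred at $0$. For $t>0$ set $$h_{\rm mle}(t)=\min\left\{\frac{m^2}{2(p+k)}\left(\sqrt{1+\frac{4(k+p)}{m^2}\,\frac{1+t}{t}}-1\right),\,1\right\},\qquad h(m,l,t)=\frac{m^2}{p}\,\frac{F\left(\frac{k+p-l}{2}+1,\frac p2+1,\frac{m^2t}{2(1+t)}\right)}{F\left(\frac{k+p-l}{2}+1,\frac p2,\frac{m^2t}{2(1+t)}\right)},$$ where $F(a,b,z)=\sum_{i\ge0}\frac{(a)_i}{(b)_i}\frac{z^i}{i!}$ is the confluent hypergeometric function. (Multipliers at $t=0$ are immaterial, since $T=0$ means $X=0$.) Then $\delta_{h_{\rm mle}}$ is a maximum likelihood estimator and, for each real $l<k+p$, $\delta_{h(m,l,\cdot)}$ is a boundary uniform estimator $\delta_{BU,l}$. Moreover, for every version of $\delta_{\rm mle}$ and $\delta_{BU,l}$: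 (a) If $p\ge2$ and $k\ge2$, or if $k=1$ and $m\le\sqrt p$, then $\delta_{\rm mle}$ dominates $X$. (b) If $m\le\sqrt p$, and $p\ge2$ or $(p,k)=(1,1)$, then $\delta_{BU,0}$ dominates $\delta_{\rm mle}$. (c) If $m\le\sqrt p$ and $0\le l<k+p$, then $\delta_{BU,l}$ dominates $X$. (d) If $0<l<k+p$, then $\delta_{BU,l}$ is inadmissible and is dominated by $\delta_{BU,0}$. (e) If $m>\sqrt p$, $p\ge2$ and $k\ge2$, then $\delta_{\rm mle}$ is inadmissible and is dominated by $\delta_h$ with $h(t)=\min\{h_{\rm mle}(t),h(m,0,t)\}$. -/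

import Mathlib

open MeasureTheory ProbabilityTheory
open scoped ENNReal

noncomputable section

namespace BoundedSNR

/-- `ℝ^p` with the Euclidean norm. -/
abbrev E (p : ℕ) : Type := EuclideanSpace ℝ (Fin p)

/-- The chi-square distribution with `k` degrees of freedom, i.e. the Gamma distribution with shape
`k / 2` and rate `1 / 2`. -/
def chiSq (k : ℕ) : Measure ℝ := gammaMeasure ((k : ℝ) / 2) (1 / 2)

/-- The joint law of the observation `(X, S²)`: `X ∼ N_p(θ, σ² I_p)` and `S² ∼ σ² χ²_k`,
independent. -/
def samplingLaw (p k : ℕ) (θ : E p) (σ : ℝ) : Measure (E p × ℝ) :=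
  (multivariateGaussian θ (σ ^ 2 • (1 : Matrix (Fin p) (Fin p) ℝ))).prod
    ((chiSq k).map (fun y => σ ^ 2 * y))

/-- The likelihood of `(θ, σ)` at the observation `(X, S²) = (x, s2)`: the joint Lebesgue density
of `(X, S²)`, which is the product of the `N_p(θ, σ² I_p)` density at `x` and of the
`σ² χ²_k` density at `s2`. -/
def likelihood (p k : ℕ) (θ : E p) (σ : ℝ) (x : E p) (s2 : ℝ) : ℝ :=
  (2 * Real.pi * σ ^ 2) ^ (-(p : ℝ) / 2) * Real.exp (-(‖x - θ‖ ^ 2 / (2 * σ ^ 2))) *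
    (gammaPDFReal ((k : ℝ) / 2) (1 / 2) (s2 / σ ^ 2) / σ ^ 2)

/-- The restricted parameter space `Θ(m)` of all `(θ, σ)` with `σ > 0` and `‖θ‖ / σ ≤ m`. -/
def paramSpace (p : ℕ) (m : ℝ) : Set (E p × ℝ) := {q | 0 < q.2 ∧ ‖q.1‖ / q.2 ≤ m}

/-- Scale invariant squared error loss. -/
def loss {p : ℕ} (θ : E p) (σ : ℝ) (d : E p) : ℝ := ‖d - θ‖ ^ 2 / σ ^ 2

/-- The risk of an estimator `δ`, a function of the observation `(X, S²)`; it is the expectation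
of a nonnegative quantity, hence takes values in `[0, ∞]`. -/
def risk (p k : ℕ) (θ : E p) (σ : ℝ) (δ : E p × ℝ → E p) : ℝ≥0∞ :=
  ∫⁻ z, ENNReal.ofReal (loss θ σ (δ z)) ∂(samplingLaw p k θ σ)

/-- `δ₂` dominates `δ₁` over `Θ(m)`: its risk is nowhere larger, and somewhere smaller. -/
def Dominates (p k : ℕ) (m : ℝ) (δ₂ δ₁ : E p × ℝ → E p) : Prop :=
  (∀ q ∈ paramSpace p m, risk p k q.1 q.2 δ₂ ≤ risk p k q.1 q.2 δ₁) ∧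
    ∃ q ∈ paramSpace p m, risk p k q.1 q.2 δ₂ < risk p k q.1 q.2 δ₁

/-- `δ` is inadmissible over `Θ(m)`: some estimator dominates it. -/
def Inadmissible (p k : ℕ) (m : ℝ) (δ : E p × ℝ → E p) : Prop :=
  ∃ δ' : E p × ℝ → E p, Measurable δ' ∧ Dominates p k m δ' δ

/-- The unbiased estimator `X`. -/
def unbiased (p : ℕ) : E p × ℝ → E p := fun z => z.1

/-- The equivariant estimator `h(T) X` with `T = ‖X‖² / S²`. -/
def equivariant (p : ℕ) (h : ℝ → ℝ) : E p × ℝ → E p := fun z => h (‖z.1‖ ^ 2 / z.2) • z.1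

/-- `δ` is a maximum likelihood estimator of `θ` over `Θ(m)`: at every observation with `S² > 0`
(which has probability one), `δ` is the `θ`-component of a maximizer of the likelihood. -/
def IsMLE (p k : ℕ) (m : ℝ) (δ : E p × ℝ → E p) : Prop :=
  ∀ (x : E p) (s2 : ℝ), 0 < s2 → ∃ σ : ℝ, (δ (x, s2), σ) ∈ paramSpace p m ∧
    ∀ q ∈ paramSpace p m, likelihood p k q.1 q.2 x s2 ≤ likelihood p k (δ (x, s2)) σ x s2

/-- The uniform probability distribution on the unit sphere of `ℝ^p` (`p ≥ 1`). -/
def sphereUniform (p : ℕ) : Measure (Metric.sphere (0 : E p) 1) :=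
  ((volume : Measure (E p)).toSphere Set.univ)⁻¹ • (volume : Measure (E p)).toSphere

/-- The (improper) boundary uniform prior on `(θ, σ²)`: `σ²` has Lebesgue density
`(σ²)^(l/2 - 1)` on `(0, ∞)` and, given `σ²`, `θ` is uniform on the sphere of radius `m σ`
centred at the origin. -/
def boundaryPrior (p : ℕ) (m l : ℝ) : Measure (E p × ℝ) :=
  ((sphereUniform p).prod ((volume.restrict (Set.Ioi (0 : ℝ))).withDensity
      (fun v => ENNReal.ofReal (v ^ (l / 2 - 1))))).map
    (fun w => ((m * Real.sqrt w.2) • (w.1 : E p), w.2))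

/-- The (unnormalized) posterior expected loss of the action `d` at the observation
`(X, S²) = (x, s2)`, for a prior `π` on `(θ, σ²)`. -/
def posteriorLoss (p k : ℕ) (π : Measure (E p × ℝ)) (x : E p) (s2 : ℝ) (d : E p) : ℝ≥0∞ :=
  ∫⁻ q, ENNReal.ofReal
    (loss q.1 (Real.sqrt q.2) d * likelihood p k q.1 (Real.sqrt q.2) x s2) ∂π

/-- `δ` is a (generalized) Bayes estimator for the prior `π` on `(θ, σ²)`: at every observation
with `S² > 0`, it has finite posterior expected loss, which no other action improves. -/
def IsGeneralizedBayes (p k : ℕ) (π : Measure (E p × ℝ)) (δ : E p × ℝ → E p) : Prop :=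
  ∀ (x : E p) (s2 : ℝ), 0 < s2 → posteriorLoss p k π x s2 (δ (x, s2)) < ∞ ∧
    ∀ d : E p, posteriorLoss p k π x s2 (δ (x, s2)) ≤ posteriorLoss p k π x s2 d

/-- `δ` is the boundary uniform Bayes estimator `δ_{BU,l}`. -/
def IsBU (p k : ℕ) (m l : ℝ) (δ : E p × ℝ → E p) : Prop :=
  IsGeneralizedBayes p k (boundaryPrior p m l) δ

/-- The confluent hypergeometric function `F(a, b, z) = ∑ (a)_i / (b)_i * z^i / i!`. -/
def confluentF (a b z : ℝ) : ℝ :=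
  ∑' i : ℕ, (ascPochhammer ℝ i).eval a / (ascPochhammer ℝ i).eval b * (z ^ i / (i.factorial : ℝ))

/-- The multiplier `h(m, l, t)`. -/
def hBU (p k : ℕ) (m l t : ℝ) : ℝ :=
  m ^ 2 / p *
    (confluentF (((k : ℝ) + p - l) / 2 + 1) ((p : ℝ) / 2 + 1) (m ^ 2 * t / (2 * (1 + t))) /
      confluentF (((k : ℝ) + p - l) / 2 + 1) ((p : ℝ) / 2) (m ^ 2 * t / (2 * (1 + t))))

/-- The multiplier `h_mle(t)`, for `t > 0`. (The value at `t = 0`, where the formula has no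
meaning, is immaterial: `T = 0` means `X = 0`, and then `h(T) X = 0` whatever `h` is.) -/
def hMLE (p k : ℕ) (m t : ℝ) : ℝ :=
  min (m ^ 2 / (2 * ((p : ℝ) + k)) *
    (Real.sqrt (1 + 4 * (((k : ℝ) + p) / m ^ 2) * ((1 + t) / t)) - 1)) 1

end BoundedSNR

end

/-! The model and the loss are invariant under rotations and changes of scale, so the risk of
`equivariant p h` depends on `(θ, σ)` only through `c = ‖θ‖ / σ`. The boundary uniform prior of
radius `c` with `l = 0`, that is `dσ² / σ²` times the uniform law on directions, is the invariant
measure on the orbit `‖θ‖ = c σ`. Averaging over the orbit therefore writes the risk at `c` as an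
integral over observations, with a positive weight, of the posterior expected loss for that prior
(`risk_equivariant_eq`). This posterior loss is a quadratic in the action centred at `h(c, 0, t) x`
(`posteriorLoss_boundaryPrior`). Hence bringing `h(t)` closer to `h(c, 0, t)` for every `t` lowers
the risk at `c`.

Moreover `h(c, 0, t)` increases with `c`, so on the parameter space every target is at most `h(m, 0,
t)`. Lowering a multiplier without passing below `h(m, 0, t)` brings it closer to all targets at
once, which is domination (`dominates_of_shrink`).

Each of (a)-(e) is then an ordering of multipliers. The facts needed are `h(m, l, ·) < m² / p`
(`hBU_lt`), `h(m, 0, ·) < h(m, l, ·)` for `l > 0` (`hBU_lt_of_pos`, by a Chebyshev association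
inequality between series), and `h(m, 0, ·) < mleRoot`, the untruncated multiplier of the maximum
likelihood estimator (`hBU_lt_mleRoot`). For the last, `mleRoot` is the positive root of a
quadratic, and a barrier argument on the Riccati equation of `F(a, b + 1, z) / F(a, b, z)` shows
that the Bayes multiplier stays below that root.

The estimators themselves are identified as follows. In the coordinates `(θ / σ, 1 / σ)` the
negative log-likelihood is convex, so first-order conditions suffice, and a quadratic remainder
gives uniqueness (`likelihood_le_of_kkt`). The Bayes multiplier comes from integrating first over
the sphere, by moments, and then over `σ²`, by inverse gamma integrals. Thus every version agrees
with the explicit multiplier wherever `S² > 0`, an event of probability one. -/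

namespace BoundedSNR

open Filter Topology Set Metric

/-! ### The confluent hypergeometric series and its derivative. -/

/-- The terms of the confluent hypergeometric series. -/
noncomputable def confluentTerm (a b z : ℝ) (i : ℕ) : ℝ :=
  (ascPochhammer ℝ i).eval a / (ascPochhammer ℝ i).eval b * (z ^ i / (i.factorial : ℝ))

lemma confluentF_eq_tsum (a b z : ℝ) : confluentF a b z = ∑' i, confluentTerm a b z i := rfl

lemma ascPochhammer_eval_succ_left (a : ℝ) (i : ℕ) :
    (ascPochhammer ℝ (i + 1)).eval a = a * (ascPochhammer ℝ i).eval (a + 1) := by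
  simp [ascPochhammer_succ_left]

lemma ascPochhammer_eval_add_one (a : ℝ) (i : ℕ) :
    a * (ascPochhammer ℝ i).eval (a + 1) = (ascPochhammer ℝ i).eval a * (a + i) := by
  rw [← ascPochhammer_eval_succ_left, ascPochhammer_succ_eval]

lemma confluentTerm_succ (a b z : ℝ) (i : ℕ) :
    confluentTerm a b z (i + 1) =
      confluentTerm a b z i * ((a + i) / (b + i) * (z / (i + 1))) := by
  simp only [confluentTerm, ascPochhammer_succ_eval, pow_succ, Nat.factorial_succ]
  push_cast
  simp only [div_eq_mul_inv, mul_inv]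
  ring

lemma summable_confluentTerm {a b : ℝ} (ha : 0 < a) (hb : 0 < b) (z : ℝ) :
    Summable (confluentTerm a b z) := by
  -- Since `(a + i) / (b + i) ≤ 1 + a / b`, this `N` makes the ratio of consecutive terms at most `1
  -- / 2` from index `N` on.
  obtain ⟨N, hN⟩ := exists_nat_ge (2 * (1 + a / b) * |z|)
  refine summable_of_ratio_norm_eventually_le (r := 1 / 2) (by norm_num) ?_
  filter_upwards [eventually_ge_atTop N] with i hi
  rw [confluentTerm_succ, norm_mul, mul_comm]
  gcongr
  have hi' : (N : ℝ) ≤ i := by exact_mod_cast hi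
  have h1 : (a + i) / (b + i) ≤ 1 + a / b := by
    rw [div_le_iff₀ (by positivity)]
    have : (1 + a / b) * (b + i) = b + i + a + a / b * i := by field_simp; ring
    rw [this]
    have : 0 ≤ a / b * i := by positivity
    linarith
  rw [Real.norm_eq_abs, abs_mul, abs_div, abs_div, abs_of_pos (by positivity : 0 < a + i),
    abs_of_pos (by positivity : 0 < b + i), abs_of_pos (by positivity : (0 : ℝ) < i + 1)]
  calc (a + i) / (b + i) * (|z| / (i + 1)) ≤ (1 + a / b) * (|z| / (i + 1)) := by gcongr
    _ ≤ 1 / 2 := by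
      rw [← mul_div_assoc, div_le_iff₀ (by positivity)]
      nlinarith

lemma confluentTerm_nonneg {a b z : ℝ} (ha : 0 < a) (hb : 0 < b) (hz : 0 ≤ z) (i : ℕ) :
    0 ≤ confluentTerm a b z i := by
  have := ascPochhammer_pos i a ha
  have := ascPochhammer_pos i b hb
  unfold confluentTerm; positivity

lemma confluentF_pos {a b z : ℝ} (ha : 0 < a) (hb : 0 < b) (hz : 0 ≤ z) :
    0 < confluentF a b z :=
  (summable_confluentTerm ha hb z).tsum_pos (confluentTerm_nonneg ha hb hz) 0
    (by simp [confluentTerm])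

lemma hasDerivAt_confluentF {a b : ℝ} (ha : 0 < a) (hb : 0 < b) (z : ℝ) :
    HasDerivAt (confluentF a b) (a / b * confluentF (a + 1) (b + 1) z) z := by
  set g' : ℕ → ℝ → ℝ := fun i y =>
    (ascPochhammer ℝ i).eval a / (ascPochhammer ℝ i).eval b * (i * y ^ (i - 1) / (i.factorial : ℝ))
  have hsucc : ∀ i y, g' (i + 1) y = a / b * confluentTerm (a + 1) (b + 1) y i := by
    intro i y
    have := ascPochhammer_pos i (b + 1) (by positivity)
    simp only [g', ascPochhammer_eval_succ_left, confluentTerm, Nat.factorial_succ,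
      Nat.add_sub_cancel]
    push_cast
    field_simp
  have hs : ∀ y, HasSum (fun i => g' i y) (a / b * confluentF (a + 1) (b + 1) y) := by
    intro y
    rw [← hasSum_nat_add_iff' 1]
    simp only [hsucc]
    have := (summable_confluentTerm (by positivity : 0 < a + 1)
      (by positivity : 0 < b + 1) y).hasSum.mul_left (a / b)
    simpa [g', confluentF_eq_tsum] using this
  rw [← (hs z).tsum_eq]
  -- Termwise differentiation on the ball of radius `|z| + 1`, where the differentiated terms are
  -- bounded by their values at `|z| + 1`.
  refine hasDerivAt_tsum_of_isPreconnected (u := fun i => g' i (|z| + 1))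
    (t := Metric.ball (0 : ℝ) (|z| + 1)) (hs _).summable Metric.isOpen_ball
    (convex_ball _ _).isPreconnected ?_ ?_ (y₀ := 0) ?_ (summable_confluentTerm ha hb 0) ?_
  · intro i y _
    exact ((hasDerivAt_pow i y).div_const _).const_mul _
  · intro i y hy
    have h1 := ascPochhammer_pos i a ha
    have h2 := ascPochhammer_pos i b hb
    have hy' : |y| ≤ |z| + 1 := by simpa using (mem_ball_zero_iff.1 hy).le
    simp only [g', norm_mul, norm_div, norm_pow, Real.norm_eq_abs, abs_of_pos h1, abs_of_pos h2,
      Nat.abs_cast]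
    gcongr
  · simp; positivity
  · simp

lemma continuous_confluentF {a b : ℝ} (ha : 0 < a) (hb : 0 < b) : Continuous (confluentF a b) :=
  continuous_iff_continuousAt.2 fun z => (hasDerivAt_confluentF ha hb z).continuousAt

/-- `F' = F(a, b, ·) + (a - b) / b * F(a, b + 1, ·)`. -/
lemma confluentF_deriv_eq {a b : ℝ} (ha : 0 < a) (hb : 0 < b) (z : ℝ) :
    a / b * confluentF (a + 1) (b + 1) z =
      confluentF a b z + (a - b) / b * confluentF a (b + 1) z := by
  have h1 := summable_confluentTerm ha hb z
  have h2 := summable_confluentTerm ha (by positivity : 0 < b + 1) z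
  simp only [confluentF_eq_tsum]
  rw [← tsum_mul_left, ← tsum_mul_left, ← h1.tsum_add (h2.mul_left _)]
  congr 1; ext i
  have p1 := ascPochhammer_pos i b hb
  have p2 := ascPochhammer_pos i (b + 1) (by positivity)
  have e1 := ascPochhammer_eval_add_one a i
  have e2 := ascPochhammer_eval_add_one b i
  have e1' : (ascPochhammer ℝ i).eval (a + 1) = (ascPochhammer ℝ i).eval a * (a + i) / a := by
    rw [eq_div_iff ha.ne', ← e1]; ring
  have e2' : (ascPochhammer ℝ i).eval (b + 1) = (ascPochhammer ℝ i).eval b * (b + i) / b := by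
    rw [eq_div_iff hb.ne', ← e2]; ring
  have : 0 < b + i := by positivity
  simp only [confluentTerm, e1', e2']
  field_simp
  ring

/-- `z F'(a, b + 1, z) = b (F(a, b, z) - F(a, b + 1, z))`. -/
lemma mul_confluentF_deriv_eq {a b : ℝ} (ha : 0 < a) (hb : 0 < b) (z : ℝ) :
    z * (a / (b + 1) * confluentF (a + 1) (b + 1 + 1) z) =
      b * (confluentF a b z - confluentF a (b + 1) z) := by
  have h1 := summable_confluentTerm ha hb z
  have h2 := summable_confluentTerm ha (by positivity : 0 < b + 1) z
  have h3 := summable_confluentTerm (by positivity : 0 < a + 1) (by positivity : 0 < b + 1 + 1) z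
  have key := ((h1.sub h2).mul_left b).hasSum
  rw [← hasSum_nat_add_iff' 1] at key
  simp only [confluentF_eq_tsum]
  rw [← h1.tsum_sub h2, ← tsum_mul_left, ← tsum_mul_left, ← tsum_mul_left]
  have h0 : b * (confluentTerm a b z 0 - confluentTerm a (b + 1) z 0) = 0 := by
    simp [confluentTerm]
  rw [Finset.sum_range_one, h0, sub_zero] at key
  rw [← key.tsum_eq]
  congr 1; ext i
  have p1 := ascPochhammer_pos i (b + 1) (by positivity)
  have p2 := ascPochhammer_pos i (b + 1 + 1) (by positivity)
  have e2 := ascPochhammer_eval_add_one (b + 1) i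
  have e2' : (ascPochhammer ℝ i).eval (b + 1) =
      (b + 1) * (ascPochhammer ℝ i).eval (b + 1 + 1) / (b + 1 + i) := by
    rw [eq_div_iff (by positivity), ← e2]
  have : 0 < b + 1 + i := by positivity
  simp only [confluentTerm, ascPochhammer_eval_succ_left, Nat.factorial_succ, e2']
  push_cast
  field_simp
  ring

/-! ### Inequalities for ratios of confluent hypergeometric functions. -/

/-- The algebra of the barrier argument, with `x = F(c + 1, b + 1, z)` and `y = F(c + 1, b, z)`: the
hypothesis is `Q = 0` and the conclusion is `z Q' < 0`, the derivatives having been eliminated.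
Solving the hypothesis for `z` leaves the sign of `c x (1 - 2 b) - b² y`, which is where `b ≥ 1 / 2`
enters. -/
lemma barrier_neg {b c x y z : ℝ} (hb : 1 / 2 ≤ b) (hc : 0 < c) (hx : 0 < x) (hy : 0 < y)
    (h : z * c * x ^ 2 + z * b * x * y - b ^ 2 * y ^ 2 = 0) :
    z * (c * x ^ 2 + b * x * y) + 2 * c * x * (z * (b * (y - x))) + z * b * (b * (y - x) * y) +
      (z * b * x - 2 * b ^ 2 * y) * (z * (y + (c + 1 - b) / b * x)) < 0 := by
  have hb0 : 0 < b := by linarith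
  have hz : z = b ^ 2 * y ^ 2 / (x * (c * x + b * y)) := by
    rw [eq_div_iff (by positivity)]; linarith
  have : z * (c * x ^ 2 + b * x * y) + 2 * c * x * (z * (b * (y - x))) + z * b * (b * (y - x) * y) +
      (z * b * x - 2 * b ^ 2 * y) * (z * (y + (c + 1 - b) / b * x)) =
      b ^ 2 * c * x * y ^ 2 * (c * x * (1 - 2 * b) - b ^ 2 * y) / (c * x + b * y) ^ 2 := by
    subst hz; field_simp; ring
  rw [this]
  refine div_neg_of_neg_of_pos (mul_neg_of_pos_of_neg (by positivity) ?_) (by positivity)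
  have : 0 ≤ c * x * (2 * b - 1) := by
    apply mul_nonneg <;> [positivity; linarith]
  have : 0 < b ^ 2 * y := by positivity
  linarith

/-- The quadratic inequality for the ratio `F(a, b + 1, z) / F(a, b, z)`, obtained from its
Riccati equation. -/
lemma confluentF_quadratic_lt {b c z : ℝ} (hb : 1 / 2 ≤ b) (hc : 0 < c) (hz : 0 ≤ z) :
    z * c * confluentF (c + 1) (b + 1) z ^ 2 +
      z * b * confluentF (c + 1) (b + 1) z * confluentF (c + 1) b z <
      b ^ 2 * confluentF (c + 1) b z ^ 2 := by
  have hb0 : 0 < b := by linarith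
  have ha : 0 < c + 1 := by linarith
  set f : ℝ → ℝ := confluentF (c + 1) (b + 1)
  set g : ℝ → ℝ := confluentF (c + 1) b
  have hfpos : ∀ y, 0 ≤ y → 0 < f y := fun y hy => confluentF_pos ha (by linarith) hy
  have hgpos : ∀ y, 0 ≤ y → 0 < g y := fun y hy => confluentF_pos ha hb0 hy
  set f' : ℝ → ℝ := fun y => (c + 1) / (b + 1) * confluentF (c + 1 + 1) (b + 1 + 1) y
  set g' : ℝ → ℝ := fun y => g y + (c + 1 - b) / b * f y
  have hf : ∀ y, HasDerivAt f (f' y) y := fun y => hasDerivAt_confluentF ha (by linarith) y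
  have hg : ∀ y, HasDerivAt g (g' y) y := fun y => by
    have := hasDerivAt_confluentF ha hb0 y
    rwa [confluentF_deriv_eq ha hb0 y] at this
  have hf' : ∀ y, y * f' y = b * (g y - f y) := fun y => mul_confluentF_deriv_eq ha hb0 y
  set Q : ℝ → ℝ := fun y => y * c * f y ^ 2 + y * b * f y * g y - b ^ 2 * g y ^ 2
  have hQ : ∀ y, HasDerivAt Q ((c * f y ^ 2 + y * c * (2 * f y * f' y)) +
      ((b * f y + y * b * f' y) * g y + y * b * f y * g' y) - b ^ 2 * (2 * g y * g' y)) y := by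
    intro y
    have h1 := (((hasDerivAt_id y).mul_const c).mul ((hf y).pow 2)).add
      (((((hasDerivAt_id y).mul_const b).mul (hf y))).mul (hg y))
    refine (h1.sub (((hg y).pow 2).const_mul (b ^ 2))).congr_deriv ?_
    simp
  set Q' : ℝ → ℝ := fun y => (c * f y ^ 2 + y * c * (2 * f y * f' y)) +
      ((b * f y + y * b * f' y) * g y + y * b * f y * g' y) - b ^ 2 * (2 * g y * g' y)
  -- `Q` starts negative at `0` and would have to be decreasing at any zero, so it cannot cross zero
  -- from below.
  have hneg : ∀ y, 0 ≤ y → Q y = 0 → Q' y < 0 := by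
    intro y hy h0
    have hy0 : 0 < y := by
      rcases hy.eq_or_lt with rfl | h
      · have := hgpos 0 le_rfl
        have : 0 < b ^ 2 * g 0 ^ 2 := by positivity
        simp only [Q] at h0; nlinarith
      · exact h
    have := barrier_neg hb hc (hfpos y hy) (hgpos y hy) h0
    rw [← hf'] at this
    have e : y * Q' y = y * (c * f y ^ 2 + b * f y * g y) + 2 * c * f y * (y * (y * f' y)) +
        y * b * ((y * f' y) * g y) + (y * b * f y - 2 * b ^ 2 * g y) * (y * g' y) := by
      simp only [Q']; ring
    have : y * Q' y < 0 := by rw [e]; exact this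
    by_contra! hcon
    linarith [mul_nonneg hy hcon]
  have hcont : Continuous Q := continuous_iff_continuousAt.2 fun y => (hQ y).continuousAt
  have hle : ∀ y, 0 ≤ y → Q y ≤ 0 := by
    intro y hy
    refine image_le_of_deriv_right_lt_deriv_boundary (f := Q) (f' := Q') (a := 0) (b := y)
      (B := fun _ => 0) (B' := fun _ => 0) hcont.continuousOn
      (fun x _ => (hQ x).hasDerivWithinAt) ?_ (fun x => hasDerivAt_const _ _) ?_
      (right_mem_Icc.2 hy)
    · have := hgpos 0 le_rfl
      have : 0 < b ^ 2 * g 0 ^ 2 := by positivity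
      simp only [Q]; nlinarith
    · intro x hx h0; exact hneg x hx.1 h0
  -- A zero of `Q` would be a local maximum, because `Q ≤ 0`, and `Q'` would vanish there.
  have hlt : Q z < 0 := by
    refine lt_of_le_of_ne (hle z hz) fun h0 => ?_
    rcases hz.eq_or_lt with rfl | hz0
    · have := hgpos 0 le_rfl
      have : 0 < b ^ 2 * g 0 ^ 2 := by positivity
      simp only [Q] at h0; nlinarith
    have hd := hneg z hz h0
    have hmax : IsLocalMax Q z := by
      filter_upwards [lt_mem_nhds hz0] with y hy
      rw [h0]; exact hle y hy.le
    exact hd.ne (hmax.hasDerivAt_eq_zero (hQ z))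
  simp only [Q] at hlt
  linarith

/-- Chebyshev's inequality for two weights with monotone likelihood ratio. -/
lemma tsum_mul_tsum_lt_of_ratio {u v r : ℕ → ℝ} (hu : Summable u) (hv : Summable v)
    (hru : Summable fun i => r i * u i) (hrv : Summable fun i => r i * v i)
    (hu0 : ∀ i, 0 ≤ u i) (hv0 : ∀ i, 0 ≤ v i) (hr0 : ∀ i, 0 ≤ r i)
    (huv : ∀ i j, i ≤ j → u j * v i ≤ u i * v j) (hr : Monotone r)
    (hr1 : r 0 < r 1) (huv1 : u 1 * v 0 < u 0 * v 1) :
    (∑' i, r i * u i) * ∑' i, v i < (∑' i, r i * v i) * ∑' i, u i := by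
  have s1 := hru.mul_of_nonneg hv (fun i => mul_nonneg (hr0 i) (hu0 i)) hv0
  have s2 := hrv.mul_of_nonneg hu (fun i => mul_nonneg (hr0 i) (hv0 i)) hu0
  rw [hru.tsum_mul_tsum hv s1, hrv.tsum_mul_tsum hu s2]
  set D : ℕ × ℕ → ℝ := fun x => r x.1 * v x.1 * u x.2 - r x.1 * u x.1 * v x.2
  have sD : Summable D := s2.sub s1
  have sD' : Summable (fun x : ℕ × ℕ => D x.swap) := (Equiv.prodComm ℕ ℕ).summable_iff.2 sD
  have eD : ∑' x, D x = (∑' x : ℕ × ℕ, r x.1 * v x.1 * u x.2) -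
      ∑' x : ℕ × ℕ, r x.1 * u x.1 * v x.2 := s2.tsum_sub s1
  have eD' : ∑' x : ℕ × ℕ, D x.swap = ∑' x, D x := (Equiv.prodComm ℕ ℕ).tsum_eq D
  -- Symmetrizing the double sum in the two indices makes each term a product of two factors of the
  -- same sign; the pair `(0, 1)` gives strictness.
  have hsum : ∀ x : ℕ × ℕ, D x + D x.swap =
      (r x.2 - r x.1) * (u x.1 * v x.2 - u x.2 * v x.1) := by
    intro x; simp only [D, Prod.fst_swap, Prod.snd_swap]; ring
  have hpos : 0 < ∑' x, (D x + D x.swap) := by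
    refine (sD.add sD').tsum_pos (fun x => ?_) (0, 1) ?_
    · rw [hsum]
      rcases le_total x.1 x.2 with h | h
      · exact mul_nonneg (sub_nonneg.2 (hr h)) (sub_nonneg.2 (huv _ _ h))
      · refine mul_nonneg_of_nonpos_of_nonpos (sub_nonpos.2 (hr h)) ?_
        have := huv _ _ h
        linarith
    · rw [hsum]
      exact mul_pos (sub_pos.2 hr1) (sub_pos.2 huv1)
  rw [sD.tsum_add sD', eD', eD] at hpos
  linarith

/-- `z ↦ z F(a, b + 1, z) / F(a, b, z)` is strictly increasing. -/
lemma confluentF_ratio_lt {a b y z : ℝ} (ha : 1 < a) (hb : 0 < b) (hy : 0 ≤ y) (hyz : y < z) :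
    y * confluentF a (b + 1) y * confluentF a b z <
      z * confluentF a (b + 1) z * confluentF a b y := by
  have ha0 : 0 < a := by linarith
  have hz : 0 ≤ z := hy.trans hyz.le
  -- With these coefficients `z F(a, b + 1, z)` is the `r`-weighted sum of the terms of `F(a, b,
  -- z)`, so the ratio is a mean of `r`. As `a > 1`, `r` increases, and raising `z` shifts the
  -- weights to larger indices.
  set r : ℕ → ℝ := fun i => b * (i / (a - 1 + i))
  have hr : ∀ w, HasSum (fun i => r i * confluentTerm a b w i) (w * confluentF a (b + 1) w) := by
    intro w
    rw [← hasSum_nat_add_iff' 1]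
    have := (summable_confluentTerm ha0 (by positivity : 0 < b + 1) w).hasSum.mul_left w
    have h0 : r 0 = 0 := by simp [r]
    simp only [Finset.sum_range_one, h0, zero_mul, sub_zero]
    refine this.congr_fun ?_
    intro i
    have p2 := ascPochhammer_pos i (b + 1) (by positivity)
    have : 0 < a + i := by positivity
    have e : a - 1 + ((i : ℝ) + 1) = a + i := by ring
    simp only [r, confluentTerm, ascPochhammer_eval_succ_left b, ascPochhammer_succ_eval i a,
      Nat.factorial_succ]
    push_cast
    rw [e]
    field_simp
    ring
  have key := tsum_mul_tsum_lt_of_ratio (u := confluentTerm a b y) (v := confluentTerm a b z) (r := r)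
    (summable_confluentTerm ha0 hb y) (summable_confluentTerm ha0 hb z) (hr y).summable
    (hr z).summable (confluentTerm_nonneg ha0 hb hy) (confluentTerm_nonneg ha0 hb hz) ?_ ?_ ?_ ?_ ?_
  · rw [(hr y).tsum_eq, (hr z).tsum_eq] at key
    exact key
  · intro i
    have : 0 < a - 1 := by linarith
    simp only [r]; positivity
  · intro i j hij
    obtain ⟨d, rfl⟩ := Nat.exists_eq_add_of_le hij
    have p1 := ascPochhammer_pos i a ha0
    have p2 := ascPochhammer_pos i b hb
    have p3 := ascPochhammer_pos (i + d) a ha0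
    have p4 := ascPochhammer_pos (i + d) b hb
    have hd : y ^ (i + d) * z ^ i ≤ y ^ i * z ^ (i + d) := by
      rw [pow_add, pow_add]
      have := pow_le_pow_left₀ hy hyz.le d
      nlinarith [mul_le_mul_of_nonneg_left this (mul_nonneg (pow_nonneg hy i) (pow_nonneg hz i))]
    simp only [confluentTerm]
    calc _ = (ascPochhammer ℝ (i + d)).eval a / (ascPochhammer ℝ (i + d)).eval b *
          ((ascPochhammer ℝ i).eval a / (ascPochhammer ℝ i).eval b) / ((i + d).factorial : ℝ) /
          (i.factorial : ℝ) * (y ^ (i + d) * z ^ i) := by ring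
      _ ≤ (ascPochhammer ℝ (i + d)).eval a / (ascPochhammer ℝ (i + d)).eval b *
          ((ascPochhammer ℝ i).eval a / (ascPochhammer ℝ i).eval b) / ((i + d).factorial : ℝ) /
          (i.factorial : ℝ) * (y ^ i * z ^ (i + d)) := by gcongr
      _ = _ := by ring
  · intro i j hij
    have : 0 < a - 1 := by linarith
    have hij' : (i : ℝ) ≤ j := by exact_mod_cast hij
    simp only [r]
    gcongr ?_ * ?_
    rcases Nat.eq_zero_or_pos i with rfl | hi
    · simp; positivity
    · have hi' : (0 : ℝ) < i := by exact_mod_cast hi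
      have hj' : (0 : ℝ) < j := by linarith
      rw [div_le_div_iff₀ (by positivity) (by positivity)]
      nlinarith
  · have : 0 < a := by linarith
    simp [r]; positivity
  · simp only [confluentTerm]
    simp
    gcongr

/-- `a ↦ F(a, b + 1, z) / F(a, b, z)` is strictly decreasing. -/
lemma confluentF_ratio_anti {a a' b z : ℝ} (ha : 0 < a) (haa : a < a') (hb : 0 < b) (hz : 0 < z) :
    confluentF a' (b + 1) z * confluentF a b z < confluentF a (b + 1) z * confluentF a' b z := by
  have ha' : 0 < a' := ha.trans haa
  -- The mean of `b / (b + i)` under the terms of `F(a, b, z)` is `F(a, b + 1, z) / F(a, b, z)`. Its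
  -- complement to `1` is used because the Chebyshev inequality needs nonnegative increasing
  -- coefficients; raising `a` shifts the weights to larger indices.
  set r : ℕ → ℝ := fun i => 1 - b / (b + i)
  have hterm : ∀ c, 0 < c → ∀ i, r i * confluentTerm c b z i =
      confluentTerm c b z i - confluentTerm c (b + 1) z i := by
    intro c hc i
    have p1 := ascPochhammer_pos i b hb
    have p2 := ascPochhammer_pos i (b + 1) (by positivity)
    have e2 := ascPochhammer_eval_add_one b i
    have e2' : (ascPochhammer ℝ i).eval (b + 1) = (ascPochhammer ℝ i).eval b * (b + i) / b := by
      rw [eq_div_iff hb.ne', ← e2]; ring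
    have : 0 < b + i := by positivity
    simp only [r, confluentTerm, e2']
    field_simp
  have hr : ∀ c, 0 < c → HasSum (fun i => r i * confluentTerm c b z i)
      (confluentF c b z - confluentF c (b + 1) z) := by
    intro c hc
    simp only [hterm c hc]
    exact (summable_confluentTerm hc hb z).hasSum.sub
      (summable_confluentTerm hc (by positivity) z).hasSum
  have key := tsum_mul_tsum_lt_of_ratio (u := confluentTerm a b z) (v := confluentTerm a' b z) (r := r)
    (summable_confluentTerm ha hb z) (summable_confluentTerm ha' hb z) (hr a ha).summable
    (hr a' ha').summable (confluentTerm_nonneg ha hb hz.le) (confluentTerm_nonneg ha' hb hz.le)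
    ?_ ?_ ?_ ?_ ?_
  · rw [(hr a ha).tsum_eq, (hr a' ha').tsum_eq, ← confluentF_eq_tsum, ← confluentF_eq_tsum] at key
    linarith
  · intro i
    simp only [r, sub_nonneg]
    exact div_le_one_of_le₀ (by simp) (by positivity)
  · intro i j hij
    have hp : (ascPochhammer ℝ j).eval a * (ascPochhammer ℝ i).eval a' ≤
        (ascPochhammer ℝ i).eval a * (ascPochhammer ℝ j).eval a' := by
      induction j, hij using Nat.le_induction with
      | base => exact le_rfl
      | succ j hj ih =>
        have p1 := ascPochhammer_pos j a' ha'
        have p2 := ascPochhammer_pos i a ha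
        rw [ascPochhammer_succ_eval, ascPochhammer_succ_eval]
        calc _ = ((ascPochhammer ℝ j).eval a * (ascPochhammer ℝ i).eval a') * (a + j) := by ring
          _ ≤ ((ascPochhammer ℝ i).eval a * (ascPochhammer ℝ j).eval a') * (a' + j) := by
            gcongr
          _ = _ := by ring
    have p2 := ascPochhammer_pos i b hb
    have p4 := ascPochhammer_pos j b hb
    simp only [confluentTerm]
    calc _ = (z ^ i / (i.factorial : ℝ)) * (z ^ j / (j.factorial : ℝ)) /
          ((ascPochhammer ℝ i).eval b) / ((ascPochhammer ℝ j).eval b) *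
          ((ascPochhammer ℝ j).eval a * (ascPochhammer ℝ i).eval a') := by ring
      _ ≤ (z ^ i / (i.factorial : ℝ)) * (z ^ j / (j.factorial : ℝ)) /
          ((ascPochhammer ℝ i).eval b) / ((ascPochhammer ℝ j).eval b) *
          ((ascPochhammer ℝ i).eval a * (ascPochhammer ℝ j).eval a') := by gcongr
      _ = _ := by ring
  · intro i j hij
    have hij' : (i : ℝ) ≤ j := by exact_mod_cast hij
    simp only [r]
    gcongr
  · simp only [r]
    simp [hb.ne']
    rw [div_lt_one (by positivity)]; linarith
  · simp only [confluentTerm]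
    simp
    gcongr

/-- Increasing the second parameter decreases the value. -/
lemma confluentF_add_one_lt {a b z : ℝ} (ha : 0 < a) (hb : 0 < b) (hz : 0 < z) :
    confluentF a (b + 1) z < confluentF a b z := by
  have h := mul_confluentF_deriv_eq ha hb z
  have : 0 < z * (a / (b + 1) * confluentF (a + 1) (b + 1 + 1) z) := by
    have := confluentF_pos (by positivity : 0 < a + 1) (by positivity : 0 < b + 1 + 1) hz.le
    positivity
  rw [h] at this
  linarith [pos_of_mul_pos_right this hb.le]

/-! ### Ordering of the multipliers. -/

section multipliers

variable {p k : ℕ} {m l t : ℝ}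

lemma hBU_nonneg (hp : 1 ≤ p) (hl : l < (k : ℝ) + p) (ht : 0 < t) : 0 ≤ hBU p k m l t := by
  have hp' : (0 : ℝ) < p := by exact_mod_cast hp
  have ha : 0 < ((k : ℝ) + p - l) / 2 + 1 := by linarith
  have hz : 0 ≤ m ^ 2 * t / (2 * (1 + t)) := by positivity
  have := confluentF_pos ha (by positivity : 0 < (p : ℝ) / 2 + 1) hz
  have := confluentF_pos ha (by positivity : 0 < (p : ℝ) / 2) hz
  unfold hBU; positivity

lemma hBU_lt (hp : 1 ≤ p) (hm : 0 < m) (hl : l < (k : ℝ) + p) (ht : 0 < t) :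
    hBU p k m l t < m ^ 2 / p := by
  have hp' : (0 : ℝ) < p := by exact_mod_cast hp
  have ha : 0 < ((k : ℝ) + p - l) / 2 + 1 := by linarith
  have hz : 0 < m ^ 2 * t / (2 * (1 + t)) := by positivity
  have h1 := confluentF_add_one_lt ha (by positivity : 0 < (p : ℝ) / 2) hz
  have h2 := confluentF_pos ha (by positivity : 0 < (p : ℝ) / 2) hz.le
  have h3 : 0 < m ^ 2 / (p : ℝ) := by positivity
  unfold hBU
  exact mul_lt_of_lt_one_right h3 ((div_lt_one h2).2 h1)

lemma hBU_strictMono_radius {m' : ℝ} (hp : 1 ≤ p) (ht : 0 < t) (hm : 0 ≤ m) (hmm : m < m') :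
    hBU p k m 0 t < hBU p k m' 0 t := by
  have hp' : (0 : ℝ) < p := by exact_mod_cast hp
  have ha : 1 < ((k : ℝ) + p - 0) / 2 + 1 := by
    have : (0 : ℝ) ≤ k := by positivity
    linarith
  have hb : 0 < (p : ℝ) / 2 := by positivity
  have hz : m ^ 2 * t / (2 * (1 + t)) < m' ^ 2 * t / (2 * (1 + t)) := by gcongr
  have h := confluentF_ratio_lt ha hb (by positivity) hz
  have ha0 : 0 < ((k : ℝ) + p - 0) / 2 + 1 := by linarith
  have hy := confluentF_pos ha0 hb (by positivity : 0 ≤ m ^ 2 * t / (2 * (1 + t)))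
  have hy' := confluentF_pos ha0 hb (by positivity : 0 ≤ m' ^ 2 * t / (2 * (1 + t)))
  -- At fixed `t` the prefactor `q ^ 2 / p` is proportional to the argument `z` of `F`, so
  -- monotonicity in the radius is that of `z F(a, b + 1, z) / F(a, b, z)`.
  have e : ∀ q : ℝ, hBU p k q 0 t = 2 * (1 + t) / (t * p) *
      ((q ^ 2 * t / (2 * (1 + t))) *
        confluentF (((k : ℝ) + p - 0) / 2 + 1) ((p : ℝ) / 2 + 1) (q ^ 2 * t / (2 * (1 + t))) /
        confluentF (((k : ℝ) + p - 0) / 2 + 1) ((p : ℝ) / 2) (q ^ 2 * t / (2 * (1 + t)))) := by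
    intro q
    have e0 : q ^ 2 / (p : ℝ) = 2 * (1 + t) / (t * p) * (q ^ 2 * t / (2 * (1 + t))) := by field_simp
    rw [hBU, e0]; ring
  rw [e, e]
  apply mul_lt_mul_of_pos_left _ (by positivity)
  rw [div_lt_div_iff₀ hy hy']
  exact h

lemma hBU_lt_of_pos (hp : 1 ≤ p) (hm : 0 < m) (hl0 : 0 < l) (hl : l < (k : ℝ) + p) (ht : 0 < t) :
    hBU p k m 0 t < hBU p k m l t := by
  have hp' : (0 : ℝ) < p := by exact_mod_cast hp
  have ha : 0 < ((k : ℝ) + p - l) / 2 + 1 := by linarith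
  have hb : 0 < (p : ℝ) / 2 := by positivity
  have hz : 0 < m ^ 2 * t / (2 * (1 + t)) := by positivity
  have h := confluentF_ratio_anti ha (by linarith : _ < ((k : ℝ) + p - 0) / 2 + 1) hb hz
  have h1 := confluentF_pos ha hb hz.le
  have h2 := confluentF_pos (by linarith : 0 < ((k : ℝ) + p - 0) / 2 + 1) hb hz.le
  unfold hBU
  apply mul_lt_mul_of_pos_left _ (by positivity)
  rw [div_lt_div_iff₀ h2 h1]
  exact h

lemma measurable_hBU (hp : 1 ≤ p) (hl : l < (k : ℝ) + p) : Measurable (hBU p k m l) := by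
  have hp' : (0 : ℝ) < p := by exact_mod_cast hp
  have ha : 0 < ((k : ℝ) + p - l) / 2 + 1 := by linarith
  have h1 := (continuous_confluentF ha (by positivity : 0 < (p : ℝ) / 2 + 1)).measurable
  have h2 := (continuous_confluentF ha (by positivity : 0 < (p : ℝ) / 2)).measurable
  have h3 : Measurable fun t : ℝ => m ^ 2 * t / (2 * (1 + t)) := by fun_prop
  exact ((h1.comp h3).div (h2.comp h3)).const_mul _

lemma measurable_hMLE : Measurable (hMLE p k m) := by
  unfold hMLE; fun_prop

/-- The untruncated multiplier of the maximum likelihood estimator. -/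
noncomputable def mleRoot (p k : ℕ) (m t : ℝ) : ℝ :=
  m ^ 2 / (2 * ((p : ℝ) + k)) *
    (Real.sqrt (1 + 4 * (((k : ℝ) + p) / m ^ 2) * ((1 + t) / t)) - 1)

lemma hMLE_eq : hMLE p k m t = min (mleRoot p k m t) 1 := rfl

lemma mleRoot_nonneg (ht : 0 ≤ t) : 0 ≤ mleRoot p k m t := by
  unfold mleRoot
  refine mul_nonneg (by positivity) (sub_nonneg.2 ?_)
  rw [Real.one_le_sqrt]
  simp; positivity

lemma hMLE_nonneg (ht : 0 ≤ t) : 0 ≤ hMLE p k m t := le_min (mleRoot_nonneg ht) zero_le_one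

lemma mleRoot_quadratic (hp : 1 ≤ p) (hm : 0 < m) (ht : 0 < t) :
    ((p : ℝ) + k) * mleRoot p k m t ^ 2 + m ^ 2 * mleRoot p k m t = m ^ 2 * ((1 + t) / t) := by
  have hp' : (0 : ℝ) < p := by exact_mod_cast hp
  have hs := Real.sq_sqrt (by positivity : 0 ≤ 1 + 4 * (((k : ℝ) + p) / m ^ 2) * ((1 + t) / t))
  set r := Real.sqrt (1 + 4 * (((k : ℝ) + p) / m ^ 2) * ((1 + t) / t)) with hr
  have e : mleRoot p k m t = m ^ 2 / (2 * ((p : ℝ) + k)) * (r - 1) := rfl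
  have hn : 0 < (p : ℝ) + k := by positivity
  rw [e]
  have : ((p : ℝ) + k) * (m ^ 2 / (2 * ((p : ℝ) + k)) * (r - 1)) ^ 2 +
      m ^ 2 * (m ^ 2 / (2 * ((p : ℝ) + k)) * (r - 1)) = m ^ 4 / (4 * ((p : ℝ) + k)) * (r ^ 2 - 1) := by
    field_simp; ring
  rw [this, hs]
  field_simp
  ring

/-- Written in terms of `hBU`, `confluentF_quadratic_lt` with `b = p / 2` and `c = (k + p) / 2` is
the strict inequality version of the equation in `mleRoot_quadratic`, whose left side increases on
nonnegative numbers. -/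
lemma hBU_lt_mleRoot (hp : 1 ≤ p) (hm : 0 < m) (ht : 0 < t) :
    hBU p k m 0 t < mleRoot p k m t := by
  have hp' : (1 : ℝ) ≤ p := by exact_mod_cast hp
  have hk' : (0 : ℝ) ≤ k := by positivity
  have hz : 0 < m ^ 2 * t / (2 * (1 + t)) := by positivity
  have hb : 1 / 2 ≤ (p : ℝ) / 2 := by linarith
  have hc : 0 < ((k : ℝ) + p - 0) / 2 := by linarith
  have h := confluentF_quadratic_lt hb hc hz.le
  have hF := confluentF_pos (by linarith : 0 < ((k : ℝ) + p - 0) / 2 + 1)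
    (by linarith : 0 < (p : ℝ) / 2) hz.le
  have hy0 := hBU_nonneg (k := k) (m := m) (l := 0) hp (by linarith) ht
  have hr0 := mleRoot_nonneg (p := p) (k := k) (m := m) ht.le
  have hq := mleRoot_quadratic (k := k) hp hm ht
  have hy : hBU p k m 0 t = m ^ 2 / p *
      (confluentF (((k : ℝ) + p - 0) / 2 + 1) ((p : ℝ) / 2 + 1) (m ^ 2 * t / (2 * (1 + t))) /
      confluentF (((k : ℝ) + p - 0) / 2 + 1) ((p : ℝ) / 2) (m ^ 2 * t / (2 * (1 + t)))) := rfl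
  set y := hBU p k m 0 t
  set f := confluentF (((k : ℝ) + p - 0) / 2 + 1) ((p : ℝ) / 2 + 1) (m ^ 2 * t / (2 * (1 + t)))
  set g := confluentF (((k : ℝ) + p - 0) / 2 + 1) ((p : ℝ) / 2) (m ^ 2 * t / (2 * (1 + t)))
  have hf : f = p / m ^ 2 * y * g := by rw [hy]; field_simp
  have key : ((p : ℝ) + k) * y ^ 2 + m ^ 2 * y < m ^ 2 * ((1 + t) / t) := by
    have e : m ^ 2 * t / (2 * (1 + t)) * (((k : ℝ) + p - 0) / 2) * f ^ 2 +
        m ^ 2 * t / (2 * (1 + t)) * ((p : ℝ) / 2) * f * g =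
        (((p : ℝ) + k) * y ^ 2 + m ^ 2 * y) * (t / (1 + t) * p ^ 2 / (4 * m ^ 2) * g ^ 2) := by
      rw [hf]; field_simp; ring
    have e' : ((p : ℝ) / 2) ^ 2 * g ^ 2 =
        (m ^ 2 * ((1 + t) / t)) * (t / (1 + t) * p ^ 2 / (4 * m ^ 2) * g ^ 2) := by
      field_simp; ring
    rw [e, e'] at h
    exact lt_of_mul_lt_mul_right h (by positivity)
  by_contra! hcon
  rw [← hq] at key
  have : mleRoot p k m t ^ 2 ≤ y ^ 2 := by gcongr
  nlinarith [mul_le_mul_of_nonneg_left this (by positivity : 0 ≤ (p : ℝ) + k),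
    mul_le_mul_of_nonneg_left hcon (by positivity : 0 ≤ m ^ 2)]

end multipliers

/-! ### The maximum likelihood estimator. -/

section mle

variable {p k : ℕ}

/-- The factor of the likelihood that depends only on the observation. -/
noncomputable def likelihoodConst (p k : ℕ) (s : ℝ) : ℝ :=
  (2 * Real.pi) ^ (-(p : ℝ) / 2) * ((1 / 2) ^ ((k : ℝ) / 2) / Real.Gamma ((k : ℝ) / 2)) *
    s ^ ((k : ℝ) / 2 - 1)

lemma likelihoodConst_pos (hk : 1 ≤ k) {s : ℝ} (hs : 0 < s) : 0 < likelihoodConst p k s := by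
  have hk' : (0 : ℝ) < k := by exact_mod_cast hk
  have := Real.Gamma_pos_of_pos (by positivity : 0 < (k : ℝ) / 2)
  have := Real.pi_pos
  unfold likelihoodConst; positivity

lemma likelihood_eq (θ x : E p) {σ s : ℝ} (hσ : 0 < σ) (hs : 0 < s) :
    likelihood p k θ σ x s =
      likelihoodConst p k s * σ⁻¹ ^ (p + k) * Real.exp (-(‖x - θ‖ ^ 2 + s) / (2 * σ ^ 2)) := by
  have hpi := Real.pi_pos
  have h0 : 0 ≤ s / σ ^ 2 := by positivity
  have h1 : (2 * Real.pi * σ ^ 2) ^ (-(p : ℝ) / 2) =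
      (2 * Real.pi) ^ (-(p : ℝ) / 2) * σ⁻¹ ^ p := by
    rw [Real.mul_rpow (by positivity) (by positivity), ← Real.rpow_natCast σ 2,
      ← Real.rpow_mul hσ.le, ← Real.rpow_natCast σ⁻¹, Real.inv_rpow hσ.le, ← Real.rpow_neg hσ.le]
    congr 2; push_cast; ring
  have h2 : (s / σ ^ 2) ^ ((k : ℝ) / 2 - 1) / σ ^ 2 = s ^ ((k : ℝ) / 2 - 1) * σ⁻¹ ^ k := by
    rw [Real.div_rpow hs.le (by positivity), div_div, div_eq_mul_inv]
    congr 1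
    have : (σ ^ 2) ^ ((k : ℝ) / 2 - 1) * σ ^ 2 = σ ^ k := by
      conv_lhs => rw [← Real.rpow_one (σ ^ 2), ← Real.rpow_mul (by positivity),
        ← Real.rpow_add (by positivity)]
      rw [← Real.rpow_natCast σ 2, ← Real.rpow_mul hσ.le, ← Real.rpow_natCast σ k]
      congr 1; push_cast; ring
    rw [this, inv_pow]
  unfold likelihood gammaPDFReal likelihoodConst
  rw [if_pos h0, h1]
  have h3 : Real.exp (-(‖x - θ‖ ^ 2 + s) / (2 * σ ^ 2)) =
      Real.exp (-(‖x - θ‖ ^ 2 / (2 * σ ^ 2))) * Real.exp (-(1 / 2 * (s / σ ^ 2))) := by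
    rw [← Real.exp_add]; congr 1; field_simp; ring
  rw [h3, pow_add]
  calc _ = (2 * Real.pi) ^ (-(p : ℝ) / 2) * σ⁻¹ ^ p * Real.exp (-(‖x - θ‖ ^ 2 / (2 * σ ^ 2))) *
        ((1 / 2) ^ ((k : ℝ) / 2) / Real.Gamma ((k : ℝ) / 2) *
        ((s / σ ^ 2) ^ ((k : ℝ) / 2 - 1) / σ ^ 2) * Real.exp (-(1 / 2 * (s / σ ^ 2)))) := by ring
    _ = _ := by rw [h2]; ring

/-- In the coordinates `w = 1 / σ`, `η = θ / σ` the negative log-likelihood is, up to a constant,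
`(‖w x - η‖² + s w²) / 2 - (p + k) log w`, which is convex. At `(u, h u x)`, `hustat` is
stationarity in `w` and `hvar` is the variational inequality for `η` in the ball of radius `m`. The
quadratic part is expanded exactly; its second-order term is kept as the exponential factor, which
later yields uniqueness. -/
lemma likelihood_le_of_kkt (hk : 1 ≤ k) {m h u s : ℝ} {x : E p} (hs : 0 < s)
    (hu : 0 < u)
    (hustat : u ^ 2 * ((1 - h) * ‖x‖ ^ 2 + s) = (p : ℝ) + k)
    (hvar : ∀ η : E p, ‖η‖ ≤ m → (1 - h) * u * inner ℝ x (η - (h * u) • x) ≤ 0)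
    {θ : E p} {σ : ℝ} (hq : (θ, σ) ∈ paramSpace p m) :
    likelihood p k θ σ x s ≤ likelihood p k (h • x) u⁻¹ x s *
      Real.exp (-(‖(σ⁻¹ - u) • x - (σ⁻¹ • θ - (h * u) • x)‖ ^ 2 + s * (σ⁻¹ - u) ^ 2) / 2) := by
  obtain ⟨hσ, hθ⟩ := hq
  simp only at hσ hθ
  rw [likelihood_eq θ x hσ hs, likelihood_eq (h • x) x (inv_pos.2 hu) hs]
  set w := σ⁻¹ with hw
  have hw0 : 0 < w := inv_pos.2 hσ
  set η := w • θ with hη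
  have hηm : ‖η‖ ≤ m := by
    rw [hη, norm_smul, Real.norm_of_nonneg hw0.le, hw, inv_mul_eq_div]; exact hθ
  have hv := hvar η hηm
  have e1 : (‖x - θ‖ ^ 2 + s) / (2 * σ ^ 2) = (‖w • x - η‖ ^ 2 + s * w ^ 2) / 2 := by
    rw [hη, ← smul_sub, norm_smul, Real.norm_of_nonneg hw0.le, hw]; field_simp
  have e2 : (‖x - h • x‖ ^ 2 + s) / (2 * u⁻¹ ^ 2) = (‖u • x - (h * u) • x‖ ^ 2 + s * u ^ 2) / 2 := by
    have : u • x - (h * u) • x = u • (x - h • x) := by module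
    rw [this, norm_smul, Real.norm_of_nonneg hu.le]; field_simp
  rw [neg_div, e1, neg_div, e2, inv_inv]
  set A := (‖w • x - η‖ ^ 2 + s * w ^ 2) / 2 with hA
  set A' := (‖u • x - (h * u) • x‖ ^ 2 + s * u ^ 2) / 2 with hA'
  set ρ := (‖(w - u) • x - (η - (h * u) • x)‖ ^ 2 + s * (w - u) ^ 2) with hρ
  have hkey : A' + ((p : ℝ) + k) * (w / u - 1) + ρ / 2 ≤ A := by
    have e3 : ((p : ℝ) + k) * (w / u - 1) = u * ((1 - h) * ‖x‖ ^ 2 + s) * (w - u) := by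
      rw [← hustat]; field_simp
    have e4 : w • x - η = (u • x - (h * u) • x) + ((w - u) • x - (η - (h * u) • x)) := by module
    have e5 : inner ℝ (u • x - (h * u) • x) ((w - u) • x - (η - (h * u) • x)) =
        (1 - h) * u * (w - u) * ‖x‖ ^ 2 - (1 - h) * u * inner ℝ x (η - (h * u) • x) := by
      have : u • x - (h * u) • x = ((1 - h) * u) • x := by module
      rw [this, inner_sub_right, real_inner_smul_left, real_inner_smul_left, inner_smul_right,
        real_inner_self_eq_norm_sq]
      ring
    rw [hA, e4, norm_add_sq_real, e5, e3, hA', hρ]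
    nlinarith
  -- Concavity of the logarithm, `log w ≤ log u + w / u - 1`, in exponential form.
  have hpow : w ^ (p + k) ≤ u ^ (p + k) * Real.exp (((p : ℝ) + k) * (w / u - 1)) := by
    have : w ≤ u * Real.exp (w / u - 1) := by
      have := Real.add_one_le_exp (w / u - 1)
      calc w = u * (w / u - 1 + 1) := by field_simp; ring
        _ ≤ _ := by gcongr
    calc w ^ (p + k) ≤ (u * Real.exp (w / u - 1)) ^ (p + k) := by gcongr
      _ = _ := by rw [mul_pow, ← Real.exp_nat_mul]; push_cast; rfl
  have hC := likelihoodConst_pos (p := p) hk hs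
  calc likelihoodConst p k s * w ^ (p + k) * Real.exp (-A)
      ≤ likelihoodConst p k s * (u ^ (p + k) * Real.exp (((p : ℝ) + k) * (w / u - 1))) *
        Real.exp (-(A' + ((p : ℝ) + k) * (w / u - 1) + ρ / 2)) := by gcongr
    _ = likelihoodConst p k s * u ^ (p + k) * Real.exp (-A') * Real.exp (-ρ / 2) := by
      have : Real.exp (((p : ℝ) + k) * (w / u - 1)) *
          Real.exp (-(A' + ((p : ℝ) + k) * (w / u - 1) + ρ / 2)) =
          Real.exp (-A') * Real.exp (-ρ / 2) := by
        rw [← Real.exp_add, ← Real.exp_add]; congr 1; ring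
      linear_combination likelihoodConst p k s * u ^ (p + k) * this

/-- Stationarity in the scale determines `u`. Then either `h = 1` and the gradient in `η` vanishes,
or `h < 1` and, for `x ≠ 0`, the quadratic for `mleRoot` says exactly `h u ‖x‖ = m`; the variational
inequality is then Cauchy-Schwarz. -/
lemma exists_kkt (hp : 1 ≤ p) {m : ℝ} (hm : 0 < m) (x : E p) {s : ℝ} (hs : 0 < s) :
    ∃ u : ℝ, 0 < u ∧
      u ^ 2 * ((1 - hMLE p k m (‖x‖ ^ 2 / s)) * ‖x‖ ^ 2 + s) = (p : ℝ) + k ∧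
      (hMLE p k m (‖x‖ ^ 2 / s) • x, u⁻¹) ∈ paramSpace p m ∧
      ∀ η : E p, ‖η‖ ≤ m → (1 - hMLE p k m (‖x‖ ^ 2 / s)) * u *
        inner ℝ x (η - (hMLE p k m (‖x‖ ^ 2 / s) * u) • x) ≤ 0 := by
  set t := ‖x‖ ^ 2 / s with ht
  have ht0 : 0 ≤ t := by positivity
  set h := hMLE p k m t with hh
  have hp' : (0 : ℝ) < p := by exact_mod_cast hp
  have hn : 0 < (p : ℝ) + k := by positivity
  have h1 : h ≤ 1 := min_le_right _ _
  have h0 : 0 ≤ h := hMLE_nonneg ht0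
  set D := (1 - h) * ‖x‖ ^ 2 + s with hD
  have hD0 : 0 < D := by
    have : 0 ≤ (1 - h) * ‖x‖ ^ 2 := mul_nonneg (by linarith) (by positivity)
    linarith
  set u := Real.sqrt (((p : ℝ) + k) / D) with hu
  have hu0 : 0 < u := Real.sqrt_pos.2 (by positivity)
  have hu2 : u ^ 2 * D = (p : ℝ) + k := by
    rw [hu, Real.sq_sqrt (by positivity)]; field_simp
  have hxt : ‖x‖ ^ 2 = t * s := by rw [ht]; field_simp
  have hcon : (h * u * ‖x‖) ^ 2 ≤ m ^ 2 ∧ (h < 1 → x ≠ 0 → (h * u * ‖x‖) ^ 2 = m ^ 2) := by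
    have e : (h * u * ‖x‖) ^ 2 * D = h ^ 2 * ((p : ℝ) + k) * (t * s) := by
      rw [← hu2, ← hxt]; ring
    have eD : D = (1 - h) * (t * s) + s := by rw [hD, hxt]
    rcases ht0.eq_or_lt with ht1 | ht1
    · have hx0 : ‖x‖ = 0 := by
        have : ‖x‖ ^ 2 = 0 := by rw [hxt, ← ht1]; ring
        simpa using this
      rw [hx0]
      exact ⟨by simp; positivity, fun _ hx => absurd (norm_eq_zero.1 hx0) hx⟩
    have hq := mleRoot_quadratic (k := k) hp hm ht1
    have hq' : (((p : ℝ) + k) * mleRoot p k m t ^ 2 + m ^ 2 * mleRoot p k m t) * t =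
        m ^ 2 * (1 + t) := by rw [hq]; field_simp
    rcases le_or_gt 1 (mleRoot p k m t) with hr | hr
    · have hh1 : h = 1 := by rw [hh, hMLE_eq, min_eq_right hr]
      refine ⟨?_, fun h' => absurd hh1 h'.ne⟩
      rw [hh1] at e eD
      rw [← mul_le_mul_iff_left₀ hD0, hh1, e, eD]
      -- The left side of the quadratic increases in the root, so a root at least `1` means its
      -- value at `1` is at most the right side; this simplifies to the claim, which is feasibility
      -- of `θ = x`.
      have h2 : ((p : ℝ) + k) * t ≤ m ^ 2 := by
        have : (1 : ℝ) ≤ mleRoot p k m t ^ 2 := one_le_pow₀ hr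
        nlinarith [mul_nonneg (mul_pos hn ht1).le (sub_nonneg.2 this),
          mul_nonneg (mul_pos (pow_pos hm 2) ht1).le (sub_nonneg.2 hr)]
      nlinarith
    · have hh1 : h = mleRoot p k m t := by rw [hh, hMLE_eq, min_eq_left hr.le]
      rw [← hh1] at hq'
      have : (h * u * ‖x‖) ^ 2 = m ^ 2 := by
        apply mul_right_cancel₀ hD0.ne'
        rw [e, eD]
        linear_combination s * hq'
      exact ⟨this.le, fun _ _ => this⟩
  refine ⟨u, hu0, hu2, ⟨inv_pos.2 hu0, ?_⟩, ?_⟩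
  · simp only [norm_smul, Real.norm_of_nonneg h0, div_inv_eq_mul]
    rw [mul_right_comm]
    exact (sq_le_sq₀ (by positivity) hm.le).1 hcon.1
  · intro η hη
    rcases h1.eq_or_lt with h1 | h1
    · simp [h1]
    rcases eq_or_ne x 0 with rfl | hx
    · simp
    have e := hcon.2 h1 hx
    have e' : h * u * ‖x‖ = m := by
      have : 0 ≤ h * u * ‖x‖ := by positivity
      exact (pow_left_inj₀ this hm.le two_ne_zero).1 e
    refine mul_nonpos_of_nonneg_of_nonpos (mul_nonneg (by linarith) hu0.le) ?_
    rw [inner_sub_right, inner_smul_right, real_inner_self_eq_norm_sq]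
    have := real_inner_le_norm x η
    have : ‖x‖ * ‖η‖ ≤ ‖x‖ * m := by gcongr
    have e'' : h * u * ‖x‖ ^ 2 = ‖x‖ * m := by rw [← e']; ring
    linarith

lemma isMLE_hMLE (hp : 1 ≤ p) (hk : 1 ≤ k) {m : ℝ} (hm : 0 < m) :
    IsMLE p k m (equivariant p (hMLE p k m)) := by
  intro x s hs
  obtain ⟨u, hu, hstat, hmem, hvar⟩ := exists_kkt (k := k) hp hm x hs
  refine ⟨u⁻¹, hmem, fun q hq => ?_⟩
  refine (likelihood_le_of_kkt hk hs hu hstat hvar hq).trans ?_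
  refine mul_le_of_le_one_right ?_ (Real.exp_le_one_iff.2 ?_)
  · have := likelihoodConst_pos (p := p) hk hs
    rw [likelihood_eq _ _ (inv_pos.2 hu) hs]; positivity
  · rw [neg_div, neg_nonpos]; positivity

/-- At another maximizer the exponential factor in `likelihood_le_of_kkt` must be at least `1`, so
both squares in its exponent vanish: the first consequence is `σ⁻¹ = u`, the second the equality of
the locations. -/
lemma IsMLE.eq_hMLE (hp : 1 ≤ p) (hk : 1 ≤ k) {m : ℝ} (hm : 0 < m) {δ : E p × ℝ → E p}
    (hδ : IsMLE p k m δ) (x : E p) {s : ℝ} (hs : 0 < s) :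
    δ (x, s) = equivariant p (hMLE p k m) (x, s) := by
  obtain ⟨u, hu, hstat, hmem, hvar⟩ := exists_kkt (k := k) hp hm x hs
  obtain ⟨σ, hq, hmax⟩ := hδ x s hs
  have h1 := hmax _ hmem
  have h2 := likelihood_le_of_kkt hk hs hu hstat hvar hq
  simp only at h1
  have hL : 0 < likelihood p k (hMLE p k m (‖x‖ ^ 2 / s) • x) u⁻¹ x s := by
    have := likelihoodConst_pos (p := p) hk hs
    rw [likelihood_eq _ _ (inv_pos.2 hu) hs]; positivity
  have h3 := (le_mul_iff_one_le_right hL).1 (h1.trans h2)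
  rw [Real.one_le_exp_iff] at h3
  have h4 : s * (σ⁻¹ - u) ^ 2 = 0 := by
    refine le_antisymm ?_ (by positivity)
    nlinarith [sq_nonneg ‖(σ⁻¹ - u) • x - (σ⁻¹ • δ (x, s) - (hMLE p k m (‖x‖ ^ 2 / s) * u) • x)‖]
  have hσ : σ⁻¹ = u := by
    have := (mul_eq_zero.1 h4).resolve_left hs.ne'
    have := pow_eq_zero_iff two_ne_zero |>.1 this
    linarith
  have h5 : ‖(σ⁻¹ - u) • x - (σ⁻¹ • δ (x, s) - (hMLE p k m (‖x‖ ^ 2 / s) * u) • x)‖ ^ 2 = 0 := by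
    refine le_antisymm ?_ (by positivity)
    rw [h4] at h3
    linarith
  rw [hσ] at h5
  have h6 := norm_eq_zero.1 (pow_eq_zero_iff two_ne_zero |>.1 h5)
  have h7 : u • (hMLE p k m (‖x‖ ^ 2 / s) • x - δ (x, s)) = 0 := by
    rw [← h6]; module
  have := (smul_eq_zero.1 h7).resolve_left hu.ne'
  exact (sub_eq_zero.1 this).symm

end mle

/-! ### Density and even moments of the standard Gaussian law. -/

lemma Gamma_add_natCast {a : ℝ} (ha : 0 < a) (i : ℕ) :
    Real.Gamma (a + i) = (ascPochhammer ℝ i).eval a * Real.Gamma a := by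
  induction i with
  | zero => simp
  | succ i ih =>
    rw [Nat.cast_succ, ← add_assoc, Real.Gamma_add_one (by positivity), ih, ascPochhammer_succ_eval]
    ring

/-- The standard Gaussian distribution has the usual density. -/
lemma stdGaussian_eq_withDensity (p : ℕ) :
    stdGaussian (E p) = (volume : Measure (E p)).withDensity
      (fun x => ENNReal.ofReal ((2 * Real.pi) ^ (-(p : ℝ) / 2) * Real.exp (-(‖x‖ ^ 2 / 2)))) := by
  have hpi := Real.pi_pos
  have hI : ∫ x : E p, (2 * Real.pi) ^ (-(p : ℝ) / 2) * Real.exp (-(‖x‖ ^ 2 / 2)) = 1 := by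
    rw [integral_const_mul]
    have := GaussianFourier.integral_rexp_neg_mul_sq_norm (V := E p) (b := 1 / 2) (by norm_num)
    have e : ∀ x : E p, Real.exp (-(‖x‖ ^ 2 / 2)) = Real.exp (-(1 / 2) * ‖x‖ ^ 2) := by
      intro x; congr 1; ring
    simp_rw [e]
    rw [this, finrank_euclideanSpace_fin, neg_div, Real.rpow_neg (by positivity)]
    have : Real.pi / (1 / 2) = 2 * Real.pi := by ring
    rw [this]
    exact inv_mul_cancel₀ (by positivity)
  have hint : Integrable fun x : E p =>
      (2 * Real.pi) ^ (-(p : ℝ) / 2) * Real.exp (-(‖x‖ ^ 2 / 2)) := by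
    -- A non-integrable function has Bochner integral `0` by convention, so the nonzero value just
    -- computed proves integrability. The same device serves for the inverse gamma integrals.
    by_contra h
    rw [integral_undef h] at hI
    exact zero_ne_one hI
  have := isFiniteMeasure_withDensity_ofReal hint.2
  apply Measure.ext_of_charFun
  ext t
  rw [charFun_stdGaussian, charFun_apply,
    integral_withDensity_eq_integral_toReal_smul (by fun_prop) (by simp)]
  have e : ∀ x : E p, (ENNReal.ofReal ((2 * Real.pi) ^ (-(p : ℝ) / 2) *
      Real.exp (-(‖x‖ ^ 2 / 2)))).toReal • Complex.exp (inner ℝ x t * Complex.I) =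
      (((2 * Real.pi) ^ (-(p : ℝ) / 2) : ℝ) : ℂ) *
        Complex.exp (-((1 / 2 : ℝ) : ℂ) * ‖x‖ ^ 2 + Complex.I * inner ℝ t x) := by
    intro x
    rw [ENNReal.toReal_ofReal (by positivity), Complex.real_smul, Complex.ofReal_mul,
      Complex.ofReal_exp, mul_assoc, ← Complex.exp_add, real_inner_comm]
    congr 2
    push_cast
    ring
  simp_rw [e]
  rw [integral_const_mul, GaussianFourier.integral_cexp_neg_mul_sq_norm_add (by simp)]
  have h2 : ((Real.pi : ℂ) / ((1 / 2 : ℝ) : ℂ)) ^ ((Module.finrank ℝ (E p) : ℂ) / 2) =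
      (((2 * Real.pi) ^ ((p : ℝ) / 2) : ℝ) : ℂ) := by
    rw [finrank_euclideanSpace_fin, Complex.ofReal_cpow (by positivity)]
    congr 1
    · push_cast; ring
    · push_cast; ring
  rw [h2, ← mul_assoc, ← Complex.ofReal_mul, ← Real.rpow_add (by positivity)]
  have : -(p : ℝ) / 2 + (p : ℝ) / 2 = 0 := by ring
  rw [this, Real.rpow_zero, Complex.ofReal_one, one_mul, Complex.I_sq]
  congr 1
  push_cast
  ring

lemma integral_pow_mul_exp_neg_sq_half (q : ℕ) :
    ∫ r in Ioi (0 : ℝ), r ^ q * Real.exp (-(r ^ 2 / 2)) =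
      (1 / 2) ^ (-((q : ℝ) + 1) / 2) * (1 / 2) * Real.Gamma (((q : ℝ) + 1) / 2) := by
  have := integral_rpow_mul_exp_neg_mul_rpow (p := 2) (q := q) (b := 1 / 2) (by norm_num)
    (by have : (0 : ℝ) ≤ q := by positivity
        linarith) (by norm_num)
  rw [← this]
  refine setIntegral_congr_fun measurableSet_Ioi fun r hr => ?_
  simp only [Real.rpow_natCast, Real.rpow_two]
  congr 2; ring

lemma integral_even_moment_gaussianReal (i : ℕ) :
    ∫ x, x ^ (2 * i) ∂(gaussianReal 0 1) = 2 ^ i * (ascPochhammer ℝ i).eval (1 / 2) := by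
  have hpi := Real.pi_pos
  rw [integral_gaussianReal_eq_integral_smul (by norm_num)]
  have e : ∀ x : ℝ, gaussianPDFReal 0 1 x • x ^ (2 * i) =
      (Real.sqrt (2 * Real.pi))⁻¹ * (|x| ^ (2 * i) * Real.exp (-(|x| ^ 2 / 2))) := by
    intro x
    have : |x| ^ (2 * i) = x ^ (2 * i) := by rw [pow_mul, pow_mul, sq_abs]
    rw [this, sq_abs, gaussianPDFReal_def, smul_eq_mul]
    simp only [NNReal.coe_one, mul_one, sub_zero]
    rw [neg_div]; ring
  simp_rw [e]
  rw [integral_const_mul, integral_comp_abs (f := fun y => y ^ (2 * i) * Real.exp (-(y ^ 2 / 2))),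
    integral_pow_mul_exp_neg_sq_half]
  have h1 : (((2 * i : ℕ) : ℝ) + 1) / 2 = 1 / 2 + i := by push_cast; ring
  have h2 : (1 / 2 : ℝ) ^ (-(((2 * i : ℕ) : ℝ) + 1) / 2) = 2 ^ i * Real.sqrt 2 := by
    rw [neg_div, h1, one_div, Real.inv_rpow (by norm_num), Real.rpow_neg (by norm_num), inv_inv,
      Real.rpow_add (by norm_num), Real.rpow_natCast, Real.sqrt_eq_rpow, one_div]
    ring
  rw [h2, h1, Gamma_add_natCast (by norm_num), Real.Gamma_one_half_eq, Real.sqrt_mul (by norm_num)]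
  field_simp

lemma integral_even_moment_stdGaussian {p : ℕ} {e : E p} (he : ‖e‖ = 1) (i : ℕ) :
    ∫ x, (inner ℝ e x) ^ (2 * i) ∂(stdGaussian (E p)) =
      2 ^ i * (ascPochhammer ℝ i).eval (1 / 2) := by
  have hmap := IsGaussian.map_eq_gaussianReal (μ := stdGaussian (E p)) (innerSL ℝ e)
  rw [integral_strongDual_stdGaussian, variance_dual_stdGaussian, innerSL_apply_norm, he] at hmap
  rw [← integral_even_moment_gaussianReal]
  have e1 : ((1 : ℝ) ^ 2).toNNReal = 1 := by simp
  rw [e1] at hmap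
  rw [← hmap, integral_map (by fun_prop) (by fun_prop)]
  rfl

/-! ### The uniform law on the sphere: moments, symmetry, exponential integrals. -/

section sphere

variable {p : ℕ}

/-- Integration in polar coordinates of a function that separates. -/
lemma integral_polar_mul (hp : 1 ≤ p) {f : E p → ℝ} {F : sphere (0 : E p) 1 → ℝ} {G : ℝ → ℝ}
    (hf : ∀ (ω : sphere (0 : E p) 1) (r : ℝ), 0 < r → f (r • (ω : E p)) = F ω * G r) :
    ∫ x, f x = (∫ ω, F ω ∂(volume : Measure (E p)).toSphere) *
      ∫ r in Ioi (0 : ℝ), r ^ (p - 1) * G r := by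
  have : Nontrivial (E p) := by
    have : Nonempty (Fin p) := ⟨⟨0, hp⟩⟩
    infer_instance
  calc ∫ x, f x = ∫ x : ({(0)}ᶜ : Set (E p)), f x ∂((volume : Measure (E p)).comap (↑)) := by
        rw [integral_subtype_comap (measurableSet_singleton _).compl fun x ↦ f x,
          restrict_compl_singleton]
    _ = ∫ x : sphere (0 : E p) 1 × Ioi (0 : ℝ), f ((x.2 : ℝ) • (x.1 : E p))
          ∂(volume : Measure (E p)).toSphere.prod (.volumeIoiPow (Module.finrank ℝ (E p) - 1)) := by
        rw [← (volume : Measure (E p)).measurePreserving_homeomorphUnitSphereProd.integral_comp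
          (Homeomorph.measurableEmbedding _)]
        refine integral_congr_ae (ae_of_all _ fun x => ?_)
        simp only
        congr 1
        have h := congrArg Subtype.val ((homeomorphUnitSphereProd (E p)).symm_apply_apply x)
        rw [← h]
        simp [smul_inv_smul₀ (norm_ne_zero_iff.2 x.2)]
    _ = ∫ x : sphere (0 : E p) 1 × Ioi (0 : ℝ), F x.1 * G x.2
          ∂(volume : Measure (E p)).toSphere.prod (.volumeIoiPow (Module.finrank ℝ (E p) - 1)) := by
        refine integral_congr_ae (ae_of_all _ fun x => ?_)
        exact hf x.1 x.2 x.2.2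
    _ = _ := by
        rw [integral_prod_mul F (fun r : Ioi (0 : ℝ) => G r), finrank_euclideanSpace_fin]
        congr 1
        simp only [Measure.volumeIoiPow, ENNReal.ofReal]
        rw [integral_withDensity_eq_integral_smul
            (measurable_subtype_coe.pow_const _).real_toNNReal,
          integral_subtype_comap measurableSet_Ioi fun a ↦ Real.toNNReal (a ^ (p - 1)) • G a]
        refine setIntegral_congr_fun measurableSet_Ioi fun x hx ↦ ?_
        simp only [NNReal.smul_def]
        rw [Real.coe_toNNReal _ (pow_nonneg hx.out.le _), smul_eq_mul]

lemma isProbabilityMeasure_sphereUniform (hp : 1 ≤ p) :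
    IsProbabilityMeasure (sphereUniform p) := by
  have : Nontrivial (E p) := by
    have : Nonempty (Fin p) := ⟨⟨0, hp⟩⟩
    infer_instance
  constructor
  rw [sphereUniform, Measure.smul_apply, smul_eq_mul]
  refine ENNReal.inv_mul_cancel ?_ (measure_ne_top _ _)
  rw [Measure.measure_univ_ne_zero]
  exact Measure.toSphere_ne_zero _

/-- The Gaussian moment of `⟨e, X⟩` is computed twice, from the one-dimensional marginal and in
polar coordinates, where the radial factor is a Gamma integral; comparing the two isolates the
spherical factor. -/
lemma integral_toSphere_even_moment (hp : 1 ≤ p) {e : E p} (he : ‖e‖ = 1) (i : ℕ) :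
    (∫ ω, (inner ℝ e (ω : E p)) ^ (2 * i) ∂(volume : Measure (E p)).toSphere) *
      (ascPochhammer ℝ i).eval ((p : ℝ) / 2) =
    (ascPochhammer ℝ i).eval (1 / 2) *
      (2 * Real.pi ^ ((p : ℝ) / 2) / Real.Gamma ((p : ℝ) / 2)) := by
  have hpi := Real.pi_pos
  have hp' : (0 : ℝ) < p := by exact_mod_cast hp
  have h := integral_even_moment_stdGaussian he i
  rw [stdGaussian_eq_withDensity, integral_withDensity_eq_integral_toReal_smul (by fun_prop)
    (by simp)] at h
  have hpol := integral_polar_mul hp (f := fun x : E p => (ENNReal.ofReal ((2 * Real.pi) ^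
      (-(p : ℝ) / 2) * Real.exp (-(‖x‖ ^ 2 / 2)))).toReal • (inner ℝ e x) ^ (2 * i))
    (F := fun ω => (inner ℝ e (ω : E p)) ^ (2 * i))
    (G := fun r => (2 * Real.pi) ^ (-(p : ℝ) / 2) * (r ^ (2 * i) * Real.exp (-(r ^ 2 / 2)))) (by
      intro ω r hr
      have : ‖(ω : E p)‖ = 1 := norm_eq_of_mem_sphere ω
      rw [ENNReal.toReal_ofReal (by positivity), norm_smul, this, inner_smul_right,
        Real.norm_of_nonneg hr.le, smul_eq_mul, mul_one]
      ring)
  rw [hpol] at h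
  have e1 : ∀ r : ℝ, r ^ (p - 1) * ((2 * Real.pi) ^ (-(p : ℝ) / 2) *
      (r ^ (2 * i) * Real.exp (-(r ^ 2 / 2)))) =
      (2 * Real.pi) ^ (-(p : ℝ) / 2) * (r ^ (p - 1 + 2 * i) * Real.exp (-(r ^ 2 / 2))) := by
    intro r; rw [pow_add]; ring
  simp_rw [e1] at h
  rw [integral_const_mul, integral_pow_mul_exp_neg_sq_half] at h
  have h1 : (((p - 1 + 2 * i : ℕ) : ℝ) + 1) / 2 = (p : ℝ) / 2 + i := by
    push_cast [Nat.cast_sub hp]; ring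
  have h2 : (1 / 2 : ℝ) ^ (-(((p - 1 + 2 * i : ℕ) : ℝ) + 1) / 2) =
      2 ^ ((p : ℝ) / 2) * 2 ^ i := by
    rw [neg_div, h1, one_div, Real.inv_rpow (by norm_num), Real.rpow_neg (by norm_num), inv_inv,
      Real.rpow_add (by norm_num), Real.rpow_natCast]
  have h3 : (2 * Real.pi) ^ (-(p : ℝ) / 2) = (2 ^ ((p : ℝ) / 2))⁻¹ * (Real.pi ^ ((p : ℝ) / 2))⁻¹ := by
    rw [neg_div, Real.rpow_neg (by positivity), Real.mul_rpow (by norm_num) hpi.le, mul_inv]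
  rw [h2, h1, h3, Gamma_add_natCast (by positivity)] at h
  have hG := Real.Gamma_pos_of_pos (by positivity : 0 < (p : ℝ) / 2)
  have h4 : (0 : ℝ) < 2 ^ ((p : ℝ) / 2) := by positivity
  have h5 : (0 : ℝ) < Real.pi ^ ((p : ℝ) / 2) := by positivity
  have h6 : (0 : ℝ) < 2 ^ i := by positivity
  field_simp at h ⊢
  linear_combination h

/-- The even moments of a coordinate of a uniform point of the sphere. -/
lemma integral_sphereUniform_even_moment (hp : 1 ≤ p) (a : E p) (i : ℕ) :
    ∫ ω, (inner ℝ a (ω : E p)) ^ (2 * i) ∂(sphereUniform p) =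
      ‖a‖ ^ (2 * i) * ((ascPochhammer ℝ i).eval (1 / 2) /
        (ascPochhammer ℝ i).eval ((p : ℝ) / 2)) := by
  have := isProbabilityMeasure_sphereUniform hp
  have hp' : (0 : ℝ) < p := by exact_mod_cast hp
  rcases eq_or_ne a 0 with rfl | ha
  · rcases Nat.eq_zero_or_pos i with rfl | hi
    · simp
    · simp [hi.ne']
  set e : E p := ‖a‖⁻¹ • a with he
  have he1 : ‖e‖ = 1 := by rw [he, norm_smul, norm_inv, norm_norm]; field_simp
  have hae : a = ‖a‖ • e := by rw [he, smul_smul]; field_simp; simp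
  have h0 := integral_toSphere_even_moment hp he1 0
  have hi := integral_toSphere_even_moment hp he1 i
  simp only [mul_zero, pow_zero, integral_const, smul_eq_mul, mul_one, ascPochhammer_zero,
    Polynomial.eval_one, one_mul] at h0
  rw [← h0] at hi
  have hpos : 0 < (volume : Measure (E p)).toSphere.real univ := by
    rw [h0]
    have := Real.Gamma_pos_of_pos (by positivity : 0 < (p : ℝ) / 2)
    have := Real.pi_pos
    positivity
  have hpoch := ascPochhammer_pos i ((p : ℝ) / 2) (by positivity)
  have hpow : ∀ ω : sphere (0 : E p) 1, (inner ℝ a (ω : E p)) ^ (2 * i) =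
      ‖a‖ ^ (2 * i) * (inner ℝ e (ω : E p)) ^ (2 * i) := by
    intro ω
    conv_lhs => rw [hae]
    rw [real_inner_smul_left, mul_pow]
  simp_rw [hpow]
  rw [integral_const_mul, sphereUniform, integral_smul_measure, ENNReal.toReal_inv, smul_eq_mul]
  change _ * (((volume : Measure (E p)).toSphere.real univ)⁻¹ * _) = _
  congr 1
  field_simp
  linarith

/-- The action of a linear isometry on the unit sphere. -/
noncomputable def sphereMap (g : E p ≃ₗᵢ[ℝ] E p) (ω : sphere (0 : E p) 1) : sphere (0 : E p) 1 :=
  ⟨g ω, by simp⟩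

lemma measurable_sphereMap (g : E p ≃ₗᵢ[ℝ] E p) : Measurable (sphereMap g) := by
  have : Continuous (sphereMap g) :=
    Continuous.subtype_mk (g.continuous.comp continuous_subtype_val) _
  exact this.measurable

/-- `toSphere` measures a set through the volume of the cone over it; isometries preserve volume and
commute with forming cones. -/
lemma measurePreserving_sphereMap (g : E p ≃ₗᵢ[ℝ] E p) :
    MeasurePreserving (sphereMap g) (sphereUniform p) (sphereUniform p) := by
  have h : MeasurePreserving (sphereMap g) (volume : Measure (E p)).toSphere
      (volume : Measure (E p)).toSphere := by
    refine ⟨measurable_sphereMap g, ?_⟩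
    ext s hs
    rw [Measure.map_apply (measurable_sphereMap g) hs, Measure.toSphere_apply' _ hs,
      Measure.toSphere_apply' _ (measurable_sphereMap g hs)]
    congr 1
    symm
    rw [← g.measurePreserving.measure_preimage_emb g.toHomeomorph.measurableEmbedding]
    symm
    congr 1
    ext x
    simp only [Set.mem_smul, mem_image, mem_preimage, Subtype.exists, mem_sphere_iff_norm, sub_zero,
      exists_and_right, exists_eq_right]
    constructor
    · rintro ⟨r, hr, y, ⟨hy, hys⟩, rfl⟩
      exact ⟨r, hr, g y, ⟨by simpa using hy, hys⟩, by simp⟩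
    · rintro ⟨r, hr, y, ⟨hy, hys⟩, hxy⟩
      refine ⟨r, hr, g.symm y, ⟨by simpa using hy, ?_⟩, ?_⟩
      · simpa [sphereMap] using hys
      · apply g.injective; simp [hxy]
  exact ⟨h.measurable, by rw [sphereUniform, Measure.map_smul, h.map_eq]⟩

lemma measurableEmbedding_sphereMap (g : E p ≃ₗᵢ[ℝ] E p) : MeasurableEmbedding (sphereMap g) := by
  have h1 : ∀ ω, sphereMap g.symm (sphereMap g ω) = ω := fun ω => Subtype.ext (by simp [sphereMap])
  have h2 : ∀ ω, sphereMap g (sphereMap g.symm ω) = ω := fun ω => Subtype.ext (by simp [sphereMap])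
  exact (MeasurableEquiv.mk ⟨sphereMap g, sphereMap g.symm, h1, h2⟩ (measurable_sphereMap g)
    (measurable_sphereMap g.symm)).measurableEmbedding

lemma integral_comp_sphereMap (g : E p ≃ₗᵢ[ℝ] E p) (f : sphere (0 : E p) 1 → ℝ) :
    ∫ ω, f (sphereMap g ω) ∂(sphereUniform p) = ∫ ω, f ω ∂(sphereUniform p) :=
  (measurePreserving_sphereMap g).integral_comp (measurableEmbedding_sphereMap g) f

lemma integrable_sphereUniform (hp : 1 ≤ p) {f : E p → ℝ} (hf : Continuous f) :
    Integrable (fun ω : sphere (0 : E p) 1 => f ω) (sphereUniform p) := by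
  have := isProbabilityMeasure_sphereUniform hp
  have hc : Continuous fun ω : sphere (0 : E p) 1 => f ω := hf.comp continuous_subtype_val
  obtain ⟨C, hC⟩ := isCompact_univ.exists_bound_of_continuousOn hc.continuousOn
  exact Integrable.of_bound hc.aestronglyMeasurable C (ae_of_all _ fun ω => hC ω (mem_univ _))

lemma abs_inner_sphere_le (a : E p) (ω : sphere (0 : E p) 1) : |inner ℝ a (ω : E p)| ≤ ‖a‖ := by
  have := abs_real_inner_le_norm a (ω : E p)
  rwa [norm_eq_of_mem_sphere ω, mul_one] at this

/-- The reflection in the line spanned by `a` preserves the law and `⟨a, ω⟩`, and reverses the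
component of `ω` orthogonal to `a`. That component averages out, so only the projection of `d` on
`a` contributes. -/
lemma integral_inner_mul_sphereUniform (hp : 1 ≤ p) (a d : E p) {f : ℝ → ℝ} (hf : Continuous f) :
    ‖a‖ ^ 2 * ∫ ω, inner ℝ d (ω : E p) * f (inner ℝ a (ω : E p)) ∂(sphereUniform p) =
      inner ℝ d a * ∫ ω, inner ℝ a (ω : E p) * f (inner ℝ a (ω : E p)) ∂(sphereUniform p) := by
  rcases eq_or_ne a 0 with rfl | ha
  · simp
  have ha' : ‖a‖ ≠ 0 := norm_ne_zero_iff.2 ha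
  set R := (Submodule.span ℝ {a}).reflection
  have hR : ∀ x : E p, R x = 2 • (inner ℝ a x / ‖a‖ ^ 2) • a - x := fun x => by
    simpa using Submodule.reflection_singleton_apply (𝕜 := ℝ) a x
  have h1 := integral_comp_sphereMap R
    (fun ω => inner ℝ d (ω : E p) * f (inner ℝ a (ω : E p)))
  have h2 : ∀ ω : sphere (0 : E p) 1,
      inner ℝ d (sphereMap R ω : E p) * f (inner ℝ a (sphereMap R ω : E p)) =
      2 * (inner ℝ d a / ‖a‖ ^ 2) * (inner ℝ a (ω : E p) * f (inner ℝ a (ω : E p))) -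
        inner ℝ d (ω : E p) * f (inner ℝ a (ω : E p)) := by
    intro ω
    have e1 : (sphereMap R ω : E p) = R ω := rfl
    have e2 : inner ℝ a (R (ω : E p)) = inner ℝ a (ω : E p) := by
      rw [hR, inner_sub_right, two_smul, inner_add_right, inner_smul_right,
        real_inner_self_eq_norm_sq]
      field_simp; ring
    rw [e1, e2, hR, inner_sub_right, two_smul, inner_add_right, inner_smul_right]
    ring
  simp_rw [h2] at h1
  rw [integral_sub, integral_const_mul] at h1
  · field_simp at h1
    linarith
  · exact (integrable_sphereUniform hp (f := fun x => inner ℝ a x * f (inner ℝ a x))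
      (by fun_prop)).const_mul _
  · exact integrable_sphereUniform hp (f := fun x => inner ℝ d x * f (inner ℝ a x)) (by fun_prop)

lemma ascPochhammer_half_mul (i : ℕ) :
    (ascPochhammer ℝ i).eval (1 / 2) * (4 ^ i * i.factorial) = (2 * i).factorial := by
  induction i with
  | zero => simp
  | succ i ih =>
    rw [ascPochhammer_succ_eval, show 2 * (i + 1) = 2 * i + 1 + 1 by ring, Nat.factorial_succ (2 * i + 1),
      Nat.factorial_succ (2 * i), Nat.factorial_succ i]
    push_cast
    rw [← ih, pow_succ]
    ring

/-- The series `∑ y ^ i / (i! (b)_i)`. -/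
noncomputable def besselSeries (b y : ℝ) : ℝ :=
  ∑' i : ℕ, y ^ i / ((i.factorial : ℝ) * (ascPochhammer ℝ i).eval b)

lemma integral_neg_sphereUniform (f : ℝ → ℝ) (a : E p) :
    ∫ ω, f (-inner ℝ a (ω : E p)) ∂(sphereUniform p) =
      ∫ ω, f (inner ℝ a (ω : E p)) ∂(sphereUniform p) := by
  rw [← integral_comp_sphereMap (LinearIsometryEquiv.neg ℝ)]
  simp [sphereMap]

/-- Symmetry under `ω ↦ -ω` replaces `exp` by `cosh`, whose series is integrated term by term with
the even moments; `(2 i)! = 4 ^ i i! (1/2)_i` cancels the numerator of the moment. -/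
lemma integral_exp_inner_sphereUniform (hp : 1 ≤ p) (a : E p) :
    ∫ ω, Real.exp (inner ℝ a (ω : E p)) ∂(sphereUniform p) =
      besselSeries ((p : ℝ) / 2) (‖a‖ ^ 2 / 4) := by
  have := isProbabilityMeasure_sphereUniform hp
  have hp' : (0 : ℝ) < p := by exact_mod_cast hp
  have h1 : ∫ ω, Real.exp (inner ℝ a (ω : E p)) ∂(sphereUniform p) =
      ∫ ω, Real.cosh (inner ℝ a (ω : E p)) ∂(sphereUniform p) := by
    have h2 := integral_neg_sphereUniform Real.exp a
    simp_rw [Real.cosh_eq]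
    rw [integral_div, integral_add, h2]
    · ring
    · exact integrable_sphereUniform hp (f := fun x => Real.exp (inner ℝ a x)) (by fun_prop)
    · exact integrable_sphereUniform hp (f := fun x => Real.exp (-inner ℝ a x)) (by fun_prop)
  rw [h1]
  have hint : ∀ i : ℕ, Integrable (fun ω : sphere (0 : E p) 1 =>
      inner ℝ a (ω : E p) ^ (2 * i) / ((2 * i).factorial : ℝ)) (sphereUniform p) := fun i =>
    integrable_sphereUniform hp (f := fun x => inner ℝ a x ^ (2 * i) / ((2 * i).factorial : ℝ))
      (by fun_prop)
  have hs := hasSum_integral_of_summable_integral_norm hint ?_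
  · have e : ∀ ω : sphere (0 : E p) 1, ∑' i : ℕ, inner ℝ a (ω : E p) ^ (2 * i) /
        ((2 * i).factorial : ℝ) = Real.cosh (inner ℝ a (ω : E p)) := fun ω =>
      (Real.hasSum_cosh _).tsum_eq
    simp_rw [e] at hs
    rw [← hs.tsum_eq, besselSeries]
    congr 1; ext i
    rw [integral_div, integral_sphereUniform_even_moment hp]
    have h1 := ascPochhammer_half_mul i
    have h3 := ascPochhammer_pos i ((p : ℝ) / 2) (by positivity)
    have h4 := ascPochhammer_pos i (1 / 2 : ℝ) (by positivity)
    rw [← h1, div_pow, ← pow_mul]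
    field_simp
  · refine (Real.hasSum_cosh ‖a‖).summable.of_nonneg_of_le
      (fun i => integral_nonneg fun ω => norm_nonneg _) fun i => ?_
    calc ∫ ω, ‖inner ℝ a (ω : E p) ^ (2 * i) / ((2 * i).factorial : ℝ)‖ ∂(sphereUniform p)
        ≤ ∫ ω, ‖a‖ ^ (2 * i) / ((2 * i).factorial : ℝ) ∂(sphereUniform p) := by
          refine integral_mono (hint i).norm (integrable_const _) fun ω => ?_
          simp only [norm_div, norm_pow, Real.norm_eq_abs, Nat.abs_cast]
          gcongr
          exact abs_inner_sphere_le a ω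
      _ = _ := by simp

lemma integral_inner_mul_exp_inner_self_sphereUniform (hp : 1 ≤ p) (a : E p) :
    ∫ ω, inner ℝ a (ω : E p) * Real.exp (inner ℝ a (ω : E p)) ∂(sphereUniform p) =
      ‖a‖ ^ 2 * (besselSeries ((p : ℝ) / 2 + 1) (‖a‖ ^ 2 / 4) / p) := by
  have := isProbabilityMeasure_sphereUniform hp
  have hp' : (0 : ℝ) < p := by exact_mod_cast hp
  have h1 : ∫ ω, inner ℝ a (ω : E p) * Real.exp (inner ℝ a (ω : E p)) ∂(sphereUniform p) =
      ∫ ω, inner ℝ a (ω : E p) * Real.sinh (inner ℝ a (ω : E p)) ∂(sphereUniform p) := by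
    have h2 := integral_neg_sphereUniform (fun y => y * Real.exp y) a
    have e : ∀ y : ℝ, y * Real.sinh y = (y * Real.exp y + (-y) * Real.exp (-y)) / 2 := by
      intro y; rw [Real.sinh_eq]; ring
    simp_rw [e]
    rw [integral_div, integral_add, h2]
    · ring
    · exact integrable_sphereUniform hp (f := fun x => inner ℝ a x * Real.exp (inner ℝ a x))
        (by fun_prop)
    · exact integrable_sphereUniform hp (f := fun x => -inner ℝ a x * Real.exp (-inner ℝ a x))
        (by fun_prop)
  rw [h1]
  have hint : ∀ i : ℕ, Integrable (fun ω : sphere (0 : E p) 1 => inner ℝ a (ω : E p) *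
      (inner ℝ a (ω : E p) ^ (2 * i + 1) / ((2 * i + 1).factorial : ℝ))) (sphereUniform p) :=
    fun i => integrable_sphereUniform hp
      (f := fun x => inner ℝ a x * (inner ℝ a x ^ (2 * i + 1) / ((2 * i + 1).factorial : ℝ)))
      (by fun_prop)
  have hs := hasSum_integral_of_summable_integral_norm hint ?_
  · have e : ∀ ω : sphere (0 : E p) 1, ∑' i : ℕ, inner ℝ a (ω : E p) *
        (inner ℝ a (ω : E p) ^ (2 * i + 1) / ((2 * i + 1).factorial : ℝ)) =
        inner ℝ a (ω : E p) * Real.sinh (inner ℝ a (ω : E p)) := fun ω =>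
      ((Real.hasSum_sinh _).mul_left _).tsum_eq
    simp_rw [e] at hs
    rw [← hs.tsum_eq, besselSeries, ← tsum_div_const, ← tsum_mul_left]
    congr 1; ext i
    have e2 : ∀ y : ℝ, y * (y ^ (2 * i + 1) / ((2 * i + 1).factorial : ℝ)) =
        y ^ (2 * (i + 1)) / ((2 * i + 1).factorial : ℝ) := by
      intro y
      rw [show 2 * (i + 1) = 2 * i + 1 + 1 by ring, pow_succ y (2 * i + 1)]; ring
    simp_rw [e2]
    rw [integral_div, integral_sphereUniform_even_moment hp, ascPochhammer_succ_eval,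
      ascPochhammer_eval_succ_left, Nat.factorial_succ]
    have h1 := ascPochhammer_half_mul i
    have h3 := ascPochhammer_pos i ((p : ℝ) / 2 + 1) (by positivity)
    have h4 := ascPochhammer_pos i (1 / 2 : ℝ) (by positivity)
    push_cast
    rw [← h1, div_pow, ← pow_mul]
    field_simp
    ring
  · refine ((Real.hasSum_sinh ‖a‖).summable.mul_left ‖a‖).of_nonneg_of_le
      (fun i => integral_nonneg fun ω => norm_nonneg _) fun i => ?_
    calc ∫ ω, ‖inner ℝ a (ω : E p) * (inner ℝ a (ω : E p) ^ (2 * i + 1) /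
          ((2 * i + 1).factorial : ℝ))‖ ∂(sphereUniform p)
        ≤ ∫ ω, ‖a‖ * (‖a‖ ^ (2 * i + 1) / ((2 * i + 1).factorial : ℝ)) ∂(sphereUniform p) := by
          refine integral_mono (hint i).norm (integrable_const _) fun ω => ?_
          simp only [norm_mul, norm_div, norm_pow, Real.norm_eq_abs, Nat.abs_cast]
          gcongr <;> exact abs_inner_sphere_le a ω
      _ = _ := by simp

lemma integral_inner_mul_exp_inner_sphereUniform (hp : 1 ≤ p) (a d : E p) :
    ∫ ω, inner ℝ d (ω : E p) * Real.exp (inner ℝ a (ω : E p)) ∂(sphereUniform p) =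
      inner ℝ d a * (besselSeries ((p : ℝ) / 2 + 1) (‖a‖ ^ 2 / 4) / p) := by
  rcases eq_or_ne a 0 with rfl | ha
  · have := integral_neg_sphereUniform (fun y => y) d
    rw [integral_neg] at this
    have h : ∫ ω, inner ℝ d (ω : E p) ∂(sphereUniform p) = 0 := by linarith
    simpa using h
  · have h := integral_inner_mul_sphereUniform hp a d Real.continuous_exp
    rw [integral_inner_mul_exp_inner_self_sphereUniform hp] at h
    have ha' : ‖a‖ ^ 2 ≠ 0 := by simpa using ha
    apply mul_left_cancel₀ ha'
    rw [h]; ring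

end sphere

/-! ### Inverse gamma integrals over the variance. -/

section inverseGamma

variable {a b c w : ℝ}

/-- The substitution `v ↦ 1 / v` gives the Gamma integral. -/
lemma integral_inverseGamma (ha : 0 < a) (hc : 0 < c) :
    ∫ v in Ioi (0 : ℝ), v ^ (-a - 1) * Real.exp (-(c / v)) = c ^ (-a) * Real.Gamma a := by
  have h := integral_comp_rpow_Ioi (fun y : ℝ => y ^ (a - 1) * Real.exp (-(c * y)))
    (p := -1) (by norm_num)
  rw [Real.integral_rpow_mul_exp_neg_mul_Ioi ha hc, one_div, Real.inv_rpow hc.le,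
    ← Real.rpow_neg hc.le] at h
  rw [← h]
  refine setIntegral_congr_fun measurableSet_Ioi fun v hv => ?_
  have hv : 0 < v := hv
  simp only [abs_neg, abs_one, one_mul, smul_eq_mul]
  rw [← mul_assoc, ← Real.rpow_mul hv.le, ← Real.rpow_add hv, Real.rpow_neg_one]
  congr 2
  ring

lemma integrableOn_inverseGamma (ha : 0 < a) (hc : 0 < c) :
    IntegrableOn (fun v : ℝ => v ^ (-a - 1) * Real.exp (-(c / v))) (Ioi 0) := by
  by_contra h
  have h1 := integral_inverseGamma ha hc
  rw [integral_undef h] at h1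
  have := Real.Gamma_pos_of_pos ha
  have : 0 < c ^ (-a) * Real.Gamma a := by positivity
  linarith

/-- Integrating term by term, the factor `Γ(a + i) = (a)_i Γ(a)` supplies the missing numerator and
turns the Bessel-type series into `F(a, b, ·)`. -/
lemma integral_inverseGamma_besselSeries (ha : 0 < a) (hb : 0 < b) (hc : 0 < c) (hw : 0 ≤ w) :
    ∫ v in Ioi (0 : ℝ), v ^ (-a - 1) * Real.exp (-(c / v)) * besselSeries b (w / v) =
      c ^ (-a) * Real.Gamma a * confluentF a b (w / c) := by
  set F : ℕ → ℝ → ℝ := fun i v =>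
    w ^ i / ((i.factorial : ℝ) * (ascPochhammer ℝ i).eval b) *
      (v ^ (-(a + i) - 1) * Real.exp (-(c / v)))
  have hai : ∀ i : ℕ, 0 < a + i := fun i => by positivity
  have hint : ∀ i, Integrable (F i) (volume.restrict (Ioi 0)) := fun i =>
    (integrableOn_inverseGamma (hai i) hc).const_mul _
  have hval : ∀ i, ∫ v in Ioi (0 : ℝ), F i v =
      c ^ (-a) * Real.Gamma a * confluentTerm a b (w / c) i := by
    intro i
    simp only [F]
    rw [integral_const_mul, integral_inverseGamma (hai i) hc, Gamma_add_natCast ha, neg_add,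
      Real.rpow_add hc, Real.rpow_neg hc.le (i : ℝ), Real.rpow_natCast, confluentTerm, div_pow]
    field_simp
  have hnorm : ∀ i, ∫ v in Ioi (0 : ℝ), ‖F i v‖ =
      c ^ (-a) * Real.Gamma a * confluentTerm a b (w / c) i := by
    intro i
    rw [← hval]
    refine setIntegral_congr_fun measurableSet_Ioi fun v hv => Real.norm_of_nonneg ?_
    have hv : 0 < v := hv
    have := ascPochhammer_pos i b hb
    positivity
  have hs := hasSum_integral_of_summable_integral_norm hint (by
    simp_rw [hnorm]
    exact (summable_confluentTerm ha hb _).mul_left _)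
  simp_rw [hval] at hs
  rw [confluentF_eq_tsum, ← tsum_mul_left, hs.tsum_eq]
  refine setIntegral_congr_fun measurableSet_Ioi fun v hv => ?_
  have hv : 0 < v := hv
  simp only [besselSeries, F]
  rw [← tsum_mul_left]
  congr 1; ext i
  have : v ^ (-(a + i) - 1) = v ^ (-a - 1) / v ^ i := by
    rw [← Real.rpow_natCast v i, ← Real.rpow_sub hv]; congr 1; ring
  rw [this, div_pow]
  ring

lemma integrableOn_inverseGamma_besselSeries (ha : 0 < a) (hb : 0 < b) (hc : 0 < c) (hw : 0 ≤ w) :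
    IntegrableOn (fun v : ℝ => v ^ (-a - 1) * Real.exp (-(c / v)) * besselSeries b (w / v))
      (Ioi 0) := by
  by_contra h
  have h1 := integral_inverseGamma_besselSeries ha hb hc hw
  rw [integral_undef h] at h1
  have := Real.Gamma_pos_of_pos ha
  have := confluentF_pos ha hb (by positivity : 0 ≤ w / c)
  have : 0 < c ^ (-a) * Real.Gamma a * confluentF a b (w / c) := by positivity
  linarith

end inverseGamma

/-! ### Posterior expected loss under the boundary uniform prior. -/

variable {p k : ℕ}

lemma measurable_likelihood :
    Measurable fun w : (E p × ℝ) × (E p × ℝ) => likelihood p k w.1.1 w.1.2 w.2.1 w.2.2 := by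
  have h := measurable_gammaPDFReal ((k : ℝ) / 2) (1 / 2)
  have h2 : Measurable fun w : (E p × ℝ) × (E p × ℝ) =>
    gammaPDFReal ((k : ℝ) / 2) (1 / 2) (w.2.2 / w.1.2 ^ 2) := h.comp (by fun_prop)
  unfold likelihood
  fun_prop

lemma measurable_loss :
    Measurable fun w : (E p × ℝ) × E p => loss w.1.1 w.1.2 w.2 := by
  unfold loss; fun_prop

lemma lintegral_boundaryPrior (hp : 1 ≤ p) (m l : ℝ) {f : E p × ℝ → ℝ≥0∞} (hf : Measurable f) :
    ∫⁻ q, f q ∂(boundaryPrior p m l) =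
      ∫⁻ v in Ioi (0 : ℝ), ENNReal.ofReal (v ^ (l / 2 - 1)) *
        ∫⁻ ω : sphere (0 : E p) 1, f ((m * Real.sqrt v) • (ω : E p), v) ∂(sphereUniform p) := by
  have := isProbabilityMeasure_sphereUniform hp
  have hT : Measurable fun w : sphere (0 : E p) 1 × ℝ =>
      ((m * Real.sqrt w.2) • (w.1 : E p), w.2) := by fun_prop
  have hd : Measurable fun v : ℝ => ENNReal.ofReal (v ^ (l / 2 - 1)) := by fun_prop
  rw [boundaryPrior, lintegral_map hf hT,
    lintegral_prod_symm (fun w : sphere (0 : E p) 1 × ℝ => f ((m * Real.sqrt w.2) • (w.1 : E p), w.2))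
      (hf.comp hT).aemeasurable,
    lintegral_withDensity_eq_lintegral_mul _ hd]
  · rfl
  · exact (hf.comp hT).lintegral_prod_left'

/-- The integrand of the posterior expected loss, expanded. -/
lemma loss_mul_likelihood (d x : E p) (ω : sphere (0 : E p) 1) {m v s : ℝ} (hv : 0 < v)
    (hs : 0 < s) :
    loss ((m * Real.sqrt v) • (ω : E p)) (Real.sqrt v) d *
      likelihood p k ((m * Real.sqrt v) • (ω : E p)) (Real.sqrt v) x s =
    likelihoodConst p k s * Real.exp (-(m ^ 2 / 2)) *
      (v ^ (-(((k : ℝ) + p) / 2)) * Real.exp (-((‖x‖ ^ 2 + s) / 2 / v))) *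
      ((‖d‖ ^ 2 / v + m ^ 2) * Real.exp (inner ℝ ((m / Real.sqrt v) • x) (ω : E p)) -
        2 * (m / Real.sqrt v) * (inner ℝ d (ω : E p) *
          Real.exp (inner ℝ ((m / Real.sqrt v) • x) (ω : E p)))) := by
  have hω : ‖(ω : E p)‖ = 1 := norm_eq_of_mem_sphere ω
  have hq : 0 < Real.sqrt v := Real.sqrt_pos.2 hv
  have hq2 : Real.sqrt v ^ 2 = v := Real.sq_sqrt hv.le
  have hnorm : ∀ y : E p, ‖y - (m * Real.sqrt v) • (ω : E p)‖ ^ 2 =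
      ‖y‖ ^ 2 - 2 * m * Real.sqrt v * inner ℝ y (ω : E p) + m ^ 2 * v := by
    intro y
    rw [norm_sub_sq_real, inner_smul_right, norm_smul, hω, mul_one, Real.norm_eq_abs, sq_abs,
      mul_pow, hq2]
    ring
  have hpow : (Real.sqrt v)⁻¹ ^ (p + k) = v ^ (-(((k : ℝ) + p) / 2)) := by
    rw [Real.sqrt_eq_rpow, ← Real.rpow_neg hv.le, ← Real.rpow_natCast, ← Real.rpow_mul hv.le]
    congr 1; push_cast; ring
  have hexp : Real.exp (-(‖x - (m * Real.sqrt v) • (ω : E p)‖ ^ 2 + s) / (2 * v)) =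
      Real.exp (-(m ^ 2 / 2)) * Real.exp (-((‖x‖ ^ 2 + s) / 2 / v)) *
        Real.exp (inner ℝ ((m / Real.sqrt v) • x) (ω : E p)) := by
    rw [← Real.exp_add, ← Real.exp_add, hnorm, real_inner_smul_left]
    congr 1
    have : m / Real.sqrt v = m * Real.sqrt v / v := by
      rw [div_eq_div_iff hq.ne' hv.ne', mul_assoc, ← pow_two, hq2]
    rw [this]
    field_simp
    ring
  have hloss : ‖d - (m * Real.sqrt v) • (ω : E p)‖ ^ 2 / v =
      ‖d‖ ^ 2 / v + m ^ 2 - 2 * (m / Real.sqrt v) * inner ℝ d (ω : E p) := by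
    have : m / Real.sqrt v = m * Real.sqrt v / v := by
      rw [div_eq_div_iff hq.ne' hv.ne', mul_assoc, ← pow_two, hq2]
    rw [hnorm, this]
    field_simp
    ring
  rw [likelihood_eq _ _ hq hs, loss, hq2, hexp, hloss, hpow]
  ring

lemma loss_nonneg (θ d : E p) (σ : ℝ) : 0 ≤ loss θ σ d := by unfold loss; positivity

lemma likelihood_nonneg (hk : 1 ≤ k) (θ x : E p) {σ s : ℝ} (hσ : 0 < σ) (hs : 0 < s) :
    0 ≤ likelihood p k θ σ x s := by
  have := likelihoodConst_pos (p := p) hk hs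
  rw [likelihood_eq _ _ hσ hs]; positivity

/-- The inner integral of the posterior loss, at fixed `σ² = v`. Nonnegativity is recorded because
the explicit formula does not show it, and it is needed to pass between `∫⁻` of `ENNReal.ofReal` and
the real integral over `v`. -/
lemma lintegral_sphere_loss_mul_likelihood (hp : 1 ≤ p) (hk : 1 ≤ k) (d x : E p) {m v s : ℝ}
    (hv : 0 < v) (hs : 0 < s) :
    ∫⁻ ω : sphere (0 : E p) 1, ENNReal.ofReal
      (loss ((m * Real.sqrt v) • (ω : E p)) (Real.sqrt v) d *
        likelihood p k ((m * Real.sqrt v) • (ω : E p)) (Real.sqrt v) x s) ∂(sphereUniform p) =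
    ENNReal.ofReal (likelihoodConst p k s * Real.exp (-(m ^ 2 / 2)) *
      (v ^ (-(((k : ℝ) + p) / 2)) * Real.exp (-((‖x‖ ^ 2 + s) / 2 / v))) *
      ((‖d‖ ^ 2 / v + m ^ 2) * besselSeries ((p : ℝ) / 2) (m ^ 2 * ‖x‖ ^ 2 / 4 / v) -
        2 * (m ^ 2 / p) * inner ℝ d x / v *
          besselSeries ((p : ℝ) / 2 + 1) (m ^ 2 * ‖x‖ ^ 2 / 4 / v))) ∧
    0 ≤ likelihoodConst p k s * Real.exp (-(m ^ 2 / 2)) *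
      (v ^ (-(((k : ℝ) + p) / 2)) * Real.exp (-((‖x‖ ^ 2 + s) / 2 / v))) *
      ((‖d‖ ^ 2 / v + m ^ 2) * besselSeries ((p : ℝ) / 2) (m ^ 2 * ‖x‖ ^ 2 / 4 / v) -
        2 * (m ^ 2 / p) * inner ℝ d x / v *
          besselSeries ((p : ℝ) / 2 + 1) (m ^ 2 * ‖x‖ ^ 2 / 4 / v)) := by
  have hq : 0 < Real.sqrt v := Real.sqrt_pos.2 hv
  have hq2 : Real.sqrt v ^ 2 = v := Real.sq_sqrt hv.le
  set a : E p := (m / Real.sqrt v) • x with ha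
  have hy : ‖a‖ ^ 2 / 4 = m ^ 2 * ‖x‖ ^ 2 / 4 / v := by
    rw [ha, norm_smul, mul_pow, Real.norm_eq_abs, sq_abs, div_pow, hq2]; ring
  have hda : (m / Real.sqrt v) * inner ℝ d a = m ^ 2 * inner ℝ d x / v := by
    rw [ha, inner_smul_right, ← mul_assoc, ← pow_two, div_pow, hq2]; ring
  set f : E p → ℝ := fun ω => likelihoodConst p k s * Real.exp (-(m ^ 2 / 2)) *
      (v ^ (-(((k : ℝ) + p) / 2)) * Real.exp (-((‖x‖ ^ 2 + s) / 2 / v))) *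
      ((‖d‖ ^ 2 / v + m ^ 2) * Real.exp (inner ℝ a ω) -
        2 * (m / Real.sqrt v) * (inner ℝ d ω * Real.exp (inner ℝ a ω))) with hf
  have hfc : Continuous f := by fun_prop
  have hint := integrable_sphereUniform hp hfc
  have hval : ∫ ω : sphere (0 : E p) 1, f ω ∂(sphereUniform p) =
      likelihoodConst p k s * Real.exp (-(m ^ 2 / 2)) *
      (v ^ (-(((k : ℝ) + p) / 2)) * Real.exp (-((‖x‖ ^ 2 + s) / 2 / v))) *
      ((‖d‖ ^ 2 / v + m ^ 2) * besselSeries ((p : ℝ) / 2) (m ^ 2 * ‖x‖ ^ 2 / 4 / v) -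
        2 * (m ^ 2 / p) * inner ℝ d x / v *
          besselSeries ((p : ℝ) / 2 + 1) (m ^ 2 * ‖x‖ ^ 2 / 4 / v)) := by
    simp only [hf]
    rw [integral_const_mul, integral_sub, integral_const_mul, integral_const_mul,
      integral_exp_inner_sphereUniform hp, integral_inner_mul_exp_inner_sphereUniform hp, hy]
    · congr 2
      linear_combination (2 * besselSeries ((p : ℝ) / 2 + 1) (m ^ 2 * ‖x‖ ^ 2 / 4 / v) / p) * hda
    · exact (integrable_sphereUniform hp (f := fun ω => Real.exp (inner ℝ a ω))
        (by fun_prop)).const_mul _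
    · exact (integrable_sphereUniform hp (f := fun ω => inner ℝ d ω * Real.exp (inner ℝ a ω))
        (by fun_prop)).const_mul _
  have hfe : ∀ ω : sphere (0 : E p) 1, loss ((m * Real.sqrt v) • (ω : E p)) (Real.sqrt v) d *
      likelihood p k ((m * Real.sqrt v) • (ω : E p)) (Real.sqrt v) x s = f ω := fun ω =>
    loss_mul_likelihood d x ω hv hs
  have hf0 : ∀ ω : sphere (0 : E p) 1, 0 ≤ f ω := fun ω => by
    rw [← hfe]
    exact mul_nonneg (loss_nonneg _ _ _) (likelihood_nonneg hk _ _ hq hs)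
  simp_rw [hfe]
  rw [← hval]
  exact ⟨(ofReal_integral_eq_lintegral_ofReal hint (ae_of_all _ hf0)).symm,
    integral_nonneg hf0⟩

/-- The posterior expected loss for the boundary uniform prior is a quadratic function of the
action, centred at `h(m, l, t) x`. -/
lemma posteriorLoss_boundaryPrior (hp : 1 ≤ p) (hk : 1 ≤ k) {m l s : ℝ}
    (hl : l < (k : ℝ) + p) (x : E p) (hs : 0 < s) :
    ∃ B C : ℝ, 0 < B ∧ 0 ≤ C ∧ ∀ d : E p, posteriorLoss p k (boundaryPrior p m l) x s d =
      ENNReal.ofReal (B * ‖d - hBU p k m l (‖x‖ ^ 2 / s) • x‖ ^ 2 + C) := by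
  have hp' : (0 : ℝ) < p := by exact_mod_cast hp
  set α : ℝ := ((k : ℝ) + p - l) / 2 with hα
  have hα0 : 0 < α := by rw [hα]; linarith
  set b : ℝ := (p : ℝ) / 2 with hb
  have hb0 : 0 < b := by positivity
  set c : ℝ := (‖x‖ ^ 2 + s) / 2 with hc
  have hc0 : 0 < c := by positivity
  set w : ℝ := m ^ 2 * ‖x‖ ^ 2 / 4 with hw
  have hw0 : 0 ≤ w := by positivity
  set K : ℝ := likelihoodConst p k s * Real.exp (-(m ^ 2 / 2)) with hK
  have hK0 : 0 < K := mul_pos (likelihoodConst_pos hk hs) (Real.exp_pos _)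
  set t : ℝ := ‖x‖ ^ 2 / s with ht
  have hz : m ^ 2 * t / (2 * (1 + t)) = w / c := by
    rw [ht, hw, hc]
    have : 0 < s + ‖x‖ ^ 2 := by positivity
    have : 0 < ‖x‖ ^ 2 + s := by positivity
    field_simp
    ring
  set h : ℝ := hBU p k m l t with hh
  -- The division of the loss by `σ²` raises `α` to `α + 1` in the terms involving `d`, whence the
  -- `+ 1` in the first parameter of `hBU`. The constant term, where `‖θ‖² / σ² = m²`, keeps `α` and
  -- gives `I3`.
  set I1 : ℝ := c ^ (-(α + 1)) * Real.Gamma (α + 1) * confluentF (α + 1) b (w / c) with hI1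
  set I2 : ℝ := c ^ (-(α + 1)) * Real.Gamma (α + 1) * confluentF (α + 1) (b + 1) (w / c) with hI2
  set I3 : ℝ := c ^ (-α) * Real.Gamma α * confluentF α b (w / c) with hI3
  have hF := confluentF_pos (by positivity : 0 < α + 1) hb0 (by positivity : 0 ≤ w / c)
  have hI1pos : 0 < I1 := by
    have := Real.Gamma_pos_of_pos (by positivity : 0 < α + 1)
    positivity
  have hrel : m ^ 2 / p * I2 = h * I1 := by
    have e : h = m ^ 2 / p * (confluentF (α + 1) (b + 1) (w / c) / confluentF (α + 1) b (w / c)) := by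
      rw [hh, hBU, hz]
    rw [e, hI1, hI2]
    field_simp
  -- the integrand after averaging over the sphere
  set g : E p → ℝ → ℝ := fun d v => K * (‖d‖ ^ 2 *
      (v ^ (-(α + 1) - 1) * Real.exp (-(c / v)) * besselSeries b (w / v)) +
      m ^ 2 * (v ^ (-α - 1) * Real.exp (-(c / v)) * besselSeries b (w / v)) -
      2 * (m ^ 2 / p) * inner ℝ d x *
        (v ^ (-(α + 1) - 1) * Real.exp (-(c / v)) * besselSeries (b + 1) (w / v))) with hg
  have hg' : ∀ d v, 0 < v → v ^ (l / 2 - 1) * (K *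
      (v ^ (-(((k : ℝ) + p) / 2)) * Real.exp (-(c / v))) *
      ((‖d‖ ^ 2 / v + m ^ 2) * besselSeries b (w / v) -
        2 * (m ^ 2 / p) * inner ℝ d x / v * besselSeries (b + 1) (w / v))) = g d v := by
    intro d v hv
    have e1 : v ^ (-α - 1) = v ^ (l / 2 - 1) * v ^ (-(((k : ℝ) + p) / 2)) := by
      rw [← Real.rpow_add hv]; congr 1; rw [hα]; ring
    have e2 : v ^ (-(α + 1) - 1) = v ^ (-α - 1) / v := by
      rw [← Real.rpow_sub_one hv.ne']; congr 1; ring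
    simp only [hg]
    rw [e2, e1]
    ring
  have i1 := integrableOn_inverseGamma_besselSeries (by positivity : 0 < α + 1) hb0 hc0 hw0
  have i2 := integrableOn_inverseGamma_besselSeries (by positivity : 0 < α + 1)
    (by positivity : 0 < b + 1) hc0 hw0
  have i3 := integrableOn_inverseGamma_besselSeries hα0 hb0 hc0 hw0
  have hgint : ∀ d, IntegrableOn (g d) (Ioi 0) := fun d =>
    (((i1.const_mul _).add (i3.const_mul _)).sub (i2.const_mul _)).const_mul _
  have hgval : ∀ d : E p, ∫ v in Ioi (0 : ℝ), g d v =
      K * (‖d‖ ^ 2 * I1 + m ^ 2 * I3 - 2 * inner ℝ d x * (h * I1)) := by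
    intro d
    simp only [hg]
    have j12 : IntegrableOn (fun v => ‖d‖ ^ 2 *
        (v ^ (-(α + 1) - 1) * Real.exp (-(c / v)) * besselSeries b (w / v)) +
        m ^ 2 * (v ^ (-α - 1) * Real.exp (-(c / v)) * besselSeries b (w / v))) (Ioi 0) :=
      (i1.const_mul _).add (i3.const_mul _)
    rw [integral_const_mul, integral_sub j12 (i2.const_mul _),
      integral_add (i1.const_mul _) (i3.const_mul _), integral_const_mul, integral_const_mul,
      integral_const_mul, integral_inverseGamma_besselSeries (by positivity : 0 < α + 1) hb0 hc0 hw0,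
      integral_inverseGamma_besselSeries (by positivity : 0 < α + 1) (by positivity : 0 < b + 1)
        hc0 hw0,
      integral_inverseGamma_besselSeries hα0 hb0 hc0 hw0, ← hrel]
    ring
  have hg0 : ∀ d, ∀ v ∈ Ioi (0 : ℝ), 0 ≤ g d v := by
    intro d v hv
    have hv : 0 < v := hv
    rw [← hg' d v hv]
    exact mul_nonneg (by positivity)
      (lintegral_sphere_loss_mul_likelihood hp hk d x hv hs).2
  have hpost : ∀ d : E p, posteriorLoss p k (boundaryPrior p m l) x s d =
      ENNReal.ofReal (∫ v in Ioi (0 : ℝ), g d v) := by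
    intro d
    rw [posteriorLoss, lintegral_boundaryPrior hp, ofReal_integral_eq_lintegral_ofReal (hgint d)]
    · refine setLIntegral_congr_fun measurableSet_Ioi fun v hv => ?_
      have hv : 0 < v := hv
      simp only
      rw [(lintegral_sphere_loss_mul_likelihood hp hk d x hv hs).1,
        ← ENNReal.ofReal_mul (by positivity), hg' d v hv]
    · filter_upwards [ae_restrict_mem measurableSet_Ioi] with v hv using hg0 d v hv
    · have h1 : Measurable fun q : E p × ℝ => loss q.1 (Real.sqrt q.2) d :=
        measurable_loss.comp (f := fun q : E p × ℝ => ((q.1, Real.sqrt q.2), d)) (by fun_prop)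
      have h2 : Measurable fun q : E p × ℝ => likelihood p k q.1 (Real.sqrt q.2) x s :=
        measurable_likelihood.comp (f := fun q : E p × ℝ => ((q.1, Real.sqrt q.2), (x, s)))
          (by fun_prop)
      exact (h1.mul h2).ennreal_ofReal
  have hsq : ∀ d : E p, ∫ v in Ioi (0 : ℝ), g d v =
      K * I1 * ‖d - h • x‖ ^ 2 + K * (m ^ 2 * I3 - h ^ 2 * ‖x‖ ^ 2 * I1) := by
    intro d
    rw [hgval, norm_sub_sq_real, inner_smul_right, norm_smul, mul_pow, Real.norm_eq_abs, sq_abs]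
    ring
  refine ⟨K * I1, K * (m ^ 2 * I3 - h ^ 2 * ‖x‖ ^ 2 * I1), by positivity, ?_, fun d => ?_⟩
  -- The constant is nonnegative because it is the posterior loss at the centre of the quadratic.
  · have := setIntegral_nonneg (μ := volume) measurableSet_Ioi (hg0 (h • x))
    rw [hsq, sub_self] at this
    simpa using this
  · rw [hpost, hsq]

lemma isBU_hBU (hp : 1 ≤ p) (hk : 1 ≤ k) {m l : ℝ} (hl : l < (k : ℝ) + p) :
    IsBU p k m l (equivariant p (hBU p k m l)) := by
  intro x s hs
  obtain ⟨B, C, hB, hC, h⟩ := posteriorLoss_boundaryPrior (m := m) hp hk hl x hs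
  refine ⟨by rw [h]; exact ENNReal.ofReal_lt_top, fun d => ?_⟩
  rw [h, h]
  apply ENNReal.ofReal_le_ofReal
  have : equivariant p (hBU p k m l) (x, s) = hBU p k m l (‖x‖ ^ 2 / s) • x := rfl
  rw [this, sub_self, norm_zero]
  have : 0 ≤ B * ‖d - hBU p k m l (‖x‖ ^ 2 / s) • x‖ ^ 2 := by positivity
  linarith

lemma IsBU.eq_hBU (hp : 1 ≤ p) (hk : 1 ≤ k) {m l : ℝ} (hl : l < (k : ℝ) + p)
    {δ : E p × ℝ → E p} (hδ : IsBU p k m l δ) (x : E p) {s : ℝ} (hs : 0 < s) :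
    δ (x, s) = equivariant p (hBU p k m l) (x, s) := by
  obtain ⟨B, C, hB, hC, h⟩ := posteriorLoss_boundaryPrior (m := m) hp hk hl x hs
  have h1 := (hδ x s hs).2 (hBU p k m l (‖x‖ ^ 2 / s) • x)
  rw [h, h, sub_self, norm_zero, ENNReal.ofReal_le_ofReal_iff (by positivity)] at h1
  have h2 : B * ‖δ (x, s) - hBU p k m l (‖x‖ ^ 2 / s) • x‖ ^ 2 = 0 :=
    le_antisymm (by linarith) (by positivity)
  have h3 := (mul_eq_zero.1 h2).resolve_left hB.ne'
  have h4 := norm_eq_zero.1 (pow_eq_zero_iff two_ne_zero |>.1 h3)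
  exact sub_eq_zero.1 h4

/-! ### Density and equivariance of the sampling law. -/

lemma map_withDensity_comp {α β : Type*} [MeasurableSpace α] [MeasurableSpace β] (μ : Measure α)
    {T : α → β} (hT : Measurable T) {g : β → ℝ≥0∞} (hg : Measurable g) :
    (μ.withDensity (fun x => g (T x))).map T = (μ.map T).withDensity g := by
  ext s hs
  rw [Measure.map_apply hT hs, withDensity_apply _ (hT hs), withDensity_apply _ hs,
    setLIntegral_map hs hg hT]

instance isProbabilityMeasure_chiSq [NeZero k] : IsProbabilityMeasure (chiSq k) := by
  have : 0 < (k : ℝ) / 2 := by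
    have : (0 : ℝ) < k := by exact_mod_cast Nat.pos_of_ne_zero (NeZero.ne k)
    positivity
  exact isProbabilityMeasure_gammaMeasure this (by norm_num)

open scoped MatrixOrder in
lemma multivariateGaussian_sq_smul_one (θ : E p) {σ : ℝ} (hσ : 0 < σ) :
    multivariateGaussian θ (σ ^ 2 • (1 : Matrix (Fin p) (Fin p) ℝ)) =
      (stdGaussian (E p)).map (fun x => θ + σ • x) := by
  have h : CFC.sqrt (σ ^ 2 • (1 : Matrix (Fin p) (Fin p) ℝ)) = σ • 1 := by
    refine CFC.sqrt_unique ?_ ?_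
    · rw [smul_mul_smul_comm, one_mul, pow_two]
    · exact (Matrix.PosSemidef.one.smul hσ.le).nonneg
  rw [multivariateGaussian, h]
  congr 1
  ext x i
  simp

lemma samplingLaw_eq_map [NeZero k] (θ : E p) {σ : ℝ} (hσ : 0 < σ) :
    samplingLaw p k θ σ = ((stdGaussian (E p)).prod (chiSq k)).map
      (fun z => (θ + σ • z.1, σ ^ 2 * z.2)) := by
  rw [samplingLaw, multivariateGaussian_sq_smul_one θ hσ,
    Measure.map_prod_map _ _ (by fun_prop) (by fun_prop)]
  rfl

lemma isProbabilityMeasure_samplingLaw [NeZero k] (θ : E p) {σ : ℝ} (hσ : 0 < σ) :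
    IsProbabilityMeasure (samplingLaw p k θ σ) := by
  rw [samplingLaw_eq_map θ hσ]
  exact Measure.isProbabilityMeasure_map (by fun_prop)

/-- The joint law of `(X, S²)` has density `likelihood`. -/
lemma samplingLaw_eq_withDensity [NeZero k] (θ : E p) {σ : ℝ} (hσ : 0 < σ) :
    samplingLaw p k θ σ = (volume : Measure (E p × ℝ)).withDensity
      (fun z => ENNReal.ofReal (likelihood p k θ σ z.1 z.2)) := by
  have hpi := Real.pi_pos
  have h1 : multivariateGaussian θ (σ ^ 2 • (1 : Matrix (Fin p) (Fin p) ℝ)) =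
      (volume : Measure (E p)).withDensity (fun x => ENNReal.ofReal
        ((2 * Real.pi * σ ^ 2) ^ (-(p : ℝ) / 2) * Real.exp (-(‖x - θ‖ ^ 2 / (2 * σ ^ 2))))) := by
    rw [multivariateGaussian_sq_smul_one θ hσ, stdGaussian_eq_withDensity]
    set g : E p → ℝ≥0∞ := fun y => ENNReal.ofReal ((2 * Real.pi) ^ (-(p : ℝ) / 2) *
      Real.exp (-(‖y - θ‖ ^ 2 / (2 * σ ^ 2)))) with hg
    have hgm : Measurable g := by fun_prop
    have e : (fun x : E p => ENNReal.ofReal ((2 * Real.pi) ^ (-(p : ℝ) / 2) *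
        Real.exp (-(‖x‖ ^ 2 / 2)))) = fun x => g (θ + σ • x) := by
      ext x
      simp only [hg]
      rw [add_sub_cancel_left, norm_smul, Real.norm_of_nonneg hσ.le]
      congr 4
      field_simp
    have hmap : (volume : Measure (E p)).map (fun x => θ + σ • x) =
        ENNReal.ofReal ((σ ^ p)⁻¹) • volume := by
      have : (fun x : E p => θ + σ • x) = (fun x => θ + x) ∘ (fun x => σ • x) := rfl
      rw [this, ← Measure.map_map (by fun_prop) (by fun_prop),
        Measure.map_addHaar_smul _ hσ.ne', Measure.map_smul, map_add_left_eq_self,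
        finrank_euclideanSpace_fin, abs_of_pos (by positivity)]
    rw [e, map_withDensity_comp _ (by fun_prop) hgm, hmap, withDensity_smul_measure,
      ← withDensity_smul _ hgm]
    congr 1
    ext x
    simp only [Pi.smul_apply, smul_eq_mul, hg]
    rw [← ENNReal.ofReal_mul (by positivity)]
    congr 1
    have : (2 * Real.pi * σ ^ 2) ^ (-(p : ℝ) / 2) = (2 * Real.pi) ^ (-(p : ℝ) / 2) * (σ ^ p)⁻¹ := by
      rw [Real.mul_rpow (by positivity) (by positivity), ← Real.rpow_natCast σ 2,
        ← Real.rpow_mul hσ.le, ← Real.rpow_natCast σ p, ← Real.rpow_neg hσ.le]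
      congr 2; push_cast; ring
    rw [this]; ring
  have h2 : (chiSq k).map (fun y => σ ^ 2 * y) = volume.withDensity
      (fun s => ENNReal.ofReal (gammaPDFReal ((k : ℝ) / 2) (1 / 2) (s / σ ^ 2) / σ ^ 2)) := by
    have hm := measurable_gammaPDFReal ((k : ℝ) / 2) (1 / 2)
    set g : ℝ → ℝ≥0∞ := fun s =>
      ENNReal.ofReal (gammaPDFReal ((k : ℝ) / 2) (1 / 2) (s / σ ^ 2)) with hg
    have hgm : Measurable g := (hm.comp (by fun_prop)).ennreal_ofReal
    have e : gammaPDF ((k : ℝ) / 2) (1 / 2) = fun x => g (σ ^ 2 * x) := by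
      ext x
      simp only [hg, gammaPDF]
      rw [mul_div_cancel_left₀ _ (by positivity)]
    rw [chiSq, gammaMeasure, e, map_withDensity_comp _ (by fun_prop) hgm,
      Real.map_volume_mul_left (by positivity), withDensity_smul_measure,
      ← withDensity_smul _ hgm]
    congr 1
    ext s
    simp only [Pi.smul_apply, smul_eq_mul, hg]
    rw [← ENNReal.ofReal_mul (by positivity), abs_of_pos (by positivity), inv_mul_eq_div]
  have hm : Measurable fun s => ENNReal.ofReal
      (gammaPDFReal ((k : ℝ) / 2) (1 / 2) (s / σ ^ 2) / σ ^ 2) :=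
    (((measurable_gammaPDFReal ((k : ℝ) / 2) (1 / 2)).comp (by fun_prop)).div_const _).ennreal_ofReal
  rw [samplingLaw, h1, h2, prod_withDensity (by fun_prop) hm]
  congr 1
  ext z
  rw [← ENNReal.ofReal_mul (by positivity)]
  rfl

lemma ae_samplingLaw_pos [NeZero k] (θ : E p) {σ : ℝ} (hσ : 0 < σ) :
    ∀ᵐ z ∂(samplingLaw p k θ σ), 0 < z.2 := by
  have hS : MeasurableSet {z : E p × ℝ | 0 < z.2} := measurableSet_lt measurable_const measurable_snd
  have h0 : ∀ᵐ y ∂(chiSq k), 0 < y := by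
    have hm : Measurable (gammaPDF ((k : ℝ) / 2) (1 / 2)) :=
      (measurable_gammaPDFReal _ _).ennreal_ofReal
    rw [chiSq, gammaMeasure, ae_withDensity_iff hm]
    filter_upwards [Measure.ae_ne volume (0 : ℝ)] with y hy hy'
    by_contra! hneg
    exact hy' (gammaPDF_of_neg (lt_of_le_of_ne hneg hy))
  rw [samplingLaw_eq_map θ hσ, ae_map_iff (by fun_prop) hS]
  have := (Measure.quasiMeasurePreserving_snd (μ := stdGaussian (E p)) (ν := chiSq k)).ae h0
  filter_upwards [this] with z hz
  positivity

lemma risk_congr [NeZero k] {θ : E p} {σ : ℝ} (hσ : 0 < σ) {δ δ' : E p × ℝ → E p}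
    (h : ∀ x s, 0 < s → δ (x, s) = δ' (x, s)) : risk p k θ σ δ = risk p k θ σ δ' := by
  refine lintegral_congr_ae ?_
  filter_upwards [ae_samplingLaw_pos θ hσ] with z hz
  rw [show z = (z.1, z.2) from rfl, h z.1 z.2 hz]

lemma lintegral_samplingLaw [NeZero k] (θ : E p) {σ : ℝ} (hσ : 0 < σ) {f : E p × ℝ → ℝ≥0∞}
    (hf : Measurable f) :
    ∫⁻ z, f z ∂(samplingLaw p k θ σ) =
      ∫⁻ z in {z : E p × ℝ | 0 < z.2}, f z * ENNReal.ofReal (likelihood p k θ σ z.1 z.2) := by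
  have hS : MeasurableSet {z : E p × ℝ | 0 < z.2} := measurableSet_lt measurable_const measurable_snd
  have hL : Measurable fun z : E p × ℝ => ENNReal.ofReal (likelihood p k θ σ z.1 z.2) :=
    (measurable_likelihood.comp (f := fun z : E p × ℝ => ((θ, σ), z)) (by fun_prop)).ennreal_ofReal
  have hr := Measure.restrict_eq_self_of_ae_mem (s := {z : E p × ℝ | 0 < z.2})
    (ae_samplingLaw_pos (k := k) θ hσ)
  rw [← hr, samplingLaw_eq_withDensity θ hσ, restrict_withDensity hS,
    lintegral_withDensity_eq_lintegral_mul _ hL hf]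
  simp only [Pi.mul_apply, mul_comm]

/-- Equivariance of the model under rotations and changes of scale. -/
lemma samplingLaw_map_smul [NeZero k] (g : E p ≃ₗᵢ[ℝ] E p) (θ : E p) {σ c : ℝ} (hσ : 0 < σ)
    (hc : 0 < c) :
    samplingLaw p k (c • g θ) (c * σ) =
      (samplingLaw p k θ σ).map (fun z => (c • g z.1, c ^ 2 * z.2)) := by
  have hg : Measurable g := g.continuous.measurable
  rw [samplingLaw_eq_map θ hσ, samplingLaw_eq_map (c • g θ) (mul_pos hc hσ),
    Measure.map_map (by fun_prop) (by fun_prop)]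
  conv_lhs => rw [← stdGaussian_map g, ← Measure.map_id (μ := chiSq k),
    Measure.map_prod_map _ _ hg measurable_id, Measure.map_map (by fun_prop) (by fun_prop)]
  congr 1
  funext z
  refine Prod.ext ?_ ?_
  · change c • g θ + (c * σ) • g z.1 = c • g (θ + σ • z.1)
    rw [map_add, map_smul, smul_add, smul_smul]
  · change (c * σ) ^ 2 * z.2 = c ^ 2 * (σ ^ 2 * z.2)
    ring

lemma exists_isometry_apply_eq {u v : E p} (h : ‖u‖ = ‖v‖) :
    ∃ g : E p ≃ₗᵢ[ℝ] E p, g u = v :=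
  ⟨_, Submodule.reflection_sub h⟩

lemma measurable_equivariant {h : ℝ → ℝ} (hh : Measurable h) : Measurable (equivariant p h) := by
  have : Measurable fun z : E p × ℝ => h (‖z.1‖ ^ 2 / z.2) := hh.comp (by fun_prop)
  exact this.smul measurable_fst

/-! ### Risk as a weighted integral of posterior expected losses. -/

/-- The weight used to integrate over the scale: `∫ ψ(v r) dv / v = 1`. -/
lemma lintegral_scale_weight {r : ℝ} (hr : 0 < r) :
    ∫⁻ v in Ioi (0 : ℝ), ENNReal.ofReal (v ^ ((0 : ℝ) / 2 - 1)) *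
      ENNReal.ofReal (v * r * Real.exp (-(v * r))) = 1 := by
  have h1 : ∫⁻ v in Ioi (0 : ℝ), ENNReal.ofReal (v ^ ((0 : ℝ) / 2 - 1)) *
      ENNReal.ofReal (v * r * Real.exp (-(v * r))) =
      ∫⁻ v in Ioi (0 : ℝ), ENNReal.ofReal (r * Real.exp (-r * v)) := by
    refine setLIntegral_congr_fun measurableSet_Ioi fun v hv => ?_
    have hv : 0 < v := hv
    rw [← ENNReal.ofReal_mul (by positivity)]
    congr 1
    rw [zero_div, zero_sub, Real.rpow_neg_one, show -(v * r) = -r * v by ring]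
    field_simp
  rw [h1, ← ofReal_integral_eq_lintegral_ofReal
    ((integrableOn_exp_mul_Ioi (by linarith : -r < 0) 0).const_mul r)
    (ae_of_all _ fun v => by positivity), integral_const_mul,
    integral_exp_mul_Ioi (by linarith : -r < 0)]
  simp only [mul_zero, Real.exp_zero]
  rw [show r * (-1 / -r) = 1 by field_simp]
  simp

lemma measurable_loss_mul_likelihood {δ : E p × ℝ → E p} (hδ : Measurable δ) :
    Measurable fun w : (E p × ℝ) × (E p × ℝ) => ENNReal.ofReal
      (loss w.1.1 (Real.sqrt w.1.2) (δ w.2) *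
        likelihood p k w.1.1 (Real.sqrt w.1.2) w.2.1 w.2.2) := by
  have h1 : Measurable fun w : (E p × ℝ) × (E p × ℝ) =>
      loss w.1.1 (Real.sqrt w.1.2) (δ w.2) :=
    measurable_loss.comp (f := fun w : (E p × ℝ) × (E p × ℝ) =>
      ((w.1.1, Real.sqrt w.1.2), δ w.2)) (by fun_prop)
  have h2 : Measurable fun w : (E p × ℝ) × (E p × ℝ) =>
      likelihood p k w.1.1 (Real.sqrt w.1.2) w.2.1 w.2.2 :=
    measurable_likelihood.comp (f := fun w : (E p × ℝ) × (E p × ℝ) =>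
      ((w.1.1, Real.sqrt w.1.2), w.2)) (by fun_prop)
  exact (h1.mul h2).ennreal_ofReal

lemma measurable_posteriorLoss {δ : E p × ℝ → E p} (hδ : Measurable δ) (π : Measure (E p × ℝ))
    [SFinite π] : Measurable fun z : E p × ℝ => posteriorLoss p k π z.1 z.2 (δ z) :=
  (measurable_loss_mul_likelihood hδ).lintegral_prod_left'

lemma setLIntegral_mul_posteriorLoss {δ : E p × ℝ → E p} (hδ : Measurable δ)
    (π : Measure (E p × ℝ)) [SFinite π] (S : Set (E p × ℝ)) {w : E p × ℝ → ℝ≥0∞}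
    (hw : Measurable w) :
    ∫⁻ z in S, w z * posteriorLoss p k π z.1 z.2 (δ z) =
      ∫⁻ q, (∫⁻ z in S, w z * ENNReal.ofReal (loss q.1 (Real.sqrt q.2) (δ z) *
        likelihood p k q.1 (Real.sqrt q.2) z.1 z.2)) ∂π := by
  have hm := measurable_loss_mul_likelihood (k := k) hδ
  rw [lintegral_lintegral_swap]
  · refine lintegral_congr fun z => ?_
    have hz : Measurable fun q : E p × ℝ => ENNReal.ofReal (loss q.1 (Real.sqrt q.2) (δ z) *
        likelihood p k q.1 (Real.sqrt q.2) z.1 z.2) :=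
      hm.comp (g := fun w : (E p × ℝ) × (E p × ℝ) => ENNReal.ofReal
        (loss w.1.1 (Real.sqrt w.1.2) (δ w.2) *
          likelihood p k w.1.1 (Real.sqrt w.1.2) w.2.1 w.2.2)) (f := fun q => (q, z)) (by fun_prop)
    rw [posteriorLoss, lintegral_const_mul _ hz]
  · exact ((hw.comp measurable_snd).mul hm).aemeasurable

/-- Risk at `(θ, σ)` rewritten by equivariance: moving the parameter to the boundary point
`((‖θ‖ / σ) √v ω, v)` only rescales the weight. -/
lemma setLIntegral_equivariant_eq [NeZero k] {h : ℝ → ℝ} (hh : Measurable h) (θ : E p)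
    {σ : ℝ} (hσ : 0 < σ) {ψ : ℝ → ℝ≥0∞} (hψ : Measurable ψ) {v : ℝ} (hv : 0 < v)
    (ω : sphere (0 : E p) 1) :
    ∫⁻ z in {z : E p × ℝ | 0 < z.2}, ψ (‖z.1‖ ^ 2 + z.2) * ENNReal.ofReal
      (loss ((‖θ‖ / σ * Real.sqrt v) • (ω : E p)) (Real.sqrt v) (equivariant p h z) *
        likelihood p k ((‖θ‖ / σ * Real.sqrt v) • (ω : E p)) (Real.sqrt v) z.1 z.2) =
      ∫⁻ z, ψ (v * ((‖z.1‖ ^ 2 + z.2) / σ ^ 2)) *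
        ENNReal.ofReal (loss θ σ (equivariant p h z)) ∂(samplingLaw p k θ σ) := by
  have hq : 0 < Real.sqrt v := Real.sqrt_pos.2 hv
  have hq2 : Real.sqrt v ^ 2 = v := Real.sq_sqrt hv.le
  have hω : ‖(ω : E p)‖ = 1 := norm_eq_of_mem_sphere ω
  -- The rotation `g` followed by the dilation by `√v / σ` carries `(θ, σ)` to the boundary point,
  -- leaves the loss unchanged and multiplies `‖X‖² + S²` by `v / σ²`.
  obtain ⟨g, hg⟩ := exists_isometry_apply_eq (u := θ) (v := ‖θ‖ • (ω : E p))
    (by rw [norm_smul, hω, norm_norm, mul_one])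
  have hc0 : 0 < Real.sqrt v / σ := by positivity
  have hcσ : Real.sqrt v = Real.sqrt v / σ * σ := by field_simp
  have hc2 : (Real.sqrt v / σ) ^ 2 = v / σ ^ 2 := by rw [div_pow, hq2]
  have hθ' : (‖θ‖ / σ * Real.sqrt v) • (ω : E p) = (Real.sqrt v / σ) • g θ := by
    rw [hg, smul_smul]; congr 1; ring
  rw [hθ']
  generalize Real.sqrt v / σ = c at hc0 hcσ hc2
  rw [hcσ]
  have hgm : Measurable g := g.continuous.measurable
  have e2 : ∀ z : E p × ℝ, equivariant p h (c • g z.1, c ^ 2 * z.2) = c • g (equivariant p h z) := by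
    intro z
    simp only [equivariant]
    rw [norm_smul, g.norm_map, mul_pow, Real.norm_eq_abs, sq_abs,
      mul_div_mul_left _ _ (by positivity), map_smul, smul_comm]
  have hδ : Measurable (equivariant p h) := measurable_equivariant hh
  generalize equivariant p h = δ at e2 hδ
  have hf : Measurable fun z : E p × ℝ => ψ (‖z.1‖ ^ 2 + z.2) *
      ENNReal.ofReal (loss (c • g θ) (c * σ) (δ z)) := by
    have : Measurable fun z : E p × ℝ => loss (c • g θ) (c * σ) (δ z) :=
      measurable_loss.comp (f := fun z : E p × ℝ => ((c • g θ, c * σ), δ z)) (by fun_prop)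
    exact (hψ.comp (by fun_prop)).mul this.ennreal_ofReal
  have h1 := lintegral_samplingLaw (k := k) (c • g θ) (mul_pos hc0 hσ) hf
  rw [samplingLaw_map_smul g θ hσ hc0, lintegral_map hf (by fun_prop)] at h1
  rw [lintegral_congr fun z : E p × ℝ => show ψ (‖z.1‖ ^ 2 + z.2) * ENNReal.ofReal
      (loss (c • g θ) (c * σ) (δ z) * likelihood p k (c • g θ) (c * σ) z.1 z.2) =
      ψ (‖z.1‖ ^ 2 + z.2) * ENNReal.ofReal (loss (c • g θ) (c * σ) (δ z)) *
        ENNReal.ofReal (likelihood p k (c • g θ) (c * σ) z.1 z.2) by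
    rw [ENNReal.ofReal_mul (loss_nonneg _ _ _), mul_assoc], ← h1]
  refine lintegral_congr fun z => ?_
  have e1 : ‖c • g z.1‖ ^ 2 + c ^ 2 * z.2 = v * ((‖z.1‖ ^ 2 + z.2) / σ ^ 2) := by
    rw [norm_smul, g.norm_map, mul_pow, Real.norm_eq_abs, sq_abs, hc2]; ring
  have e3 : loss (c • g θ) (c * σ) (δ (c • g z.1, c ^ 2 * z.2)) = loss θ σ (δ z) := by
    rw [e2, loss, loss, ← smul_sub, ← map_sub, norm_smul, g.norm_map, mul_pow, mul_pow,
      Real.norm_eq_abs, sq_abs, mul_div_mul_left _ _ (by positivity)]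
  rw [e1, e3]

lemma sfinite_boundaryPrior (hp : 1 ≤ p) (m l : ℝ) : SFinite (boundaryPrior p m l) := by
  have := isProbabilityMeasure_sphereUniform hp
  unfold boundaryPrior
  infer_instance

/-- The risk of an equivariant estimator at `(θ, σ)` is a weighted integral of its posterior
expected losses for the boundary uniform prior with `l = 0` and radius `‖θ‖ / σ`. -/
lemma risk_equivariant_eq [NeZero k] (hp : 1 ≤ p) {h : ℝ → ℝ} (hh : Measurable h) (θ : E p)
    {σ : ℝ} (hσ : 0 < σ) :
    risk p k θ σ (equivariant p h) =
      ∫⁻ z in {z : E p × ℝ | 0 < z.2},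
        ENNReal.ofReal ((‖z.1‖ ^ 2 + z.2) * Real.exp (-(‖z.1‖ ^ 2 + z.2))) *
        posteriorLoss p k (boundaryPrior p (‖θ‖ / σ) 0) z.1 z.2 (equivariant p h z) := by
  have := isProbabilityMeasure_sphereUniform hp
  have := sfinite_boundaryPrior hp (‖θ‖ / σ) 0
  have := isProbabilityMeasure_samplingLaw (k := k) θ hσ
  have hδ : Measurable (equivariant p h) := measurable_equivariant hh
  have hψ : Measurable fun r : ℝ => ENNReal.ofReal (r * Real.exp (-r)) := by fun_prop
  have hψ' : Measurable fun w : (E p × ℝ) × ℝ =>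
      ENNReal.ofReal (w.2 * ((‖w.1.1‖ ^ 2 + w.1.2) / σ ^ 2) *
        Real.exp (-(w.2 * ((‖w.1.1‖ ^ 2 + w.1.2) / σ ^ 2)))) := by fun_prop
  have hinner := fun v hv => setLIntegral_equivariant_eq (k := k) hh θ hσ hψ (v := v) hv
  have hm := measurable_loss_mul_likelihood (k := k) hδ
  have hl : Measurable fun z => ENNReal.ofReal (loss θ σ (equivariant p h z)) :=
    (measurable_loss.comp (f := fun z : E p × ℝ => ((θ, σ), equivariant p h z))
      (by fun_prop)).ennreal_ofReal
  have hΦ : Measurable fun w : (E p × ℝ) × (E p × ℝ) =>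
      ENNReal.ofReal ((‖w.2.1‖ ^ 2 + w.2.2) * Real.exp (-(‖w.2.1‖ ^ 2 + w.2.2))) *
      ENNReal.ofReal (loss w.1.1 (Real.sqrt w.1.2) (equivariant p h w.2) *
        likelihood p k w.1.1 (Real.sqrt w.1.2) w.2.1 w.2.2) :=
    Measurable.mul (by fun_prop) hm
  rw [setLIntegral_mul_posteriorLoss hδ _ _ (by fun_prop),
    lintegral_boundaryPrior hp _ 0 hΦ.lintegral_prod_right']
  rw [risk]
  generalize equivariant p h = δ at *
  -- Insert `1` in the form of the scale integral, exchange the integrals by Tonelli, and move each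
  -- `v` slice to the boundary point by equivariance. Scale invariance of `dv / v` is what singles
  -- out `l = 0`.
  calc ∫⁻ z, ENNReal.ofReal (loss θ σ (δ z)) ∂(samplingLaw p k θ σ)
      = ∫⁻ z, (∫⁻ v in Ioi (0 : ℝ), ENNReal.ofReal (v ^ ((0 : ℝ) / 2 - 1)) *
          ENNReal.ofReal (v * ((‖z.1‖ ^ 2 + z.2) / σ ^ 2) *
            Real.exp (-(v * ((‖z.1‖ ^ 2 + z.2) / σ ^ 2))))) * ENNReal.ofReal (loss θ σ (δ z))
          ∂(samplingLaw p k θ σ) := by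
        refine lintegral_congr_ae ?_
        filter_upwards [ae_samplingLaw_pos θ hσ] with z hz
        rw [lintegral_scale_weight (by positivity), one_mul]
    _ = ∫⁻ z, (∫⁻ v in Ioi (0 : ℝ), ENNReal.ofReal (v ^ ((0 : ℝ) / 2 - 1)) *
          (ENNReal.ofReal (v * ((‖z.1‖ ^ 2 + z.2) / σ ^ 2) *
            Real.exp (-(v * ((‖z.1‖ ^ 2 + z.2) / σ ^ 2)))) * ENNReal.ofReal (loss θ σ (δ z))))
          ∂(samplingLaw p k θ σ) := by
        refine lintegral_congr fun z => ?_
        rw [← lintegral_mul_const _ (by fun_prop)]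
        simp_rw [mul_assoc]
    _ = ∫⁻ v in Ioi (0 : ℝ), (∫⁻ z, ENNReal.ofReal (v ^ ((0 : ℝ) / 2 - 1)) *
          (ENNReal.ofReal (v * ((‖z.1‖ ^ 2 + z.2) / σ ^ 2) *
            Real.exp (-(v * ((‖z.1‖ ^ 2 + z.2) / σ ^ 2)))) * ENNReal.ofReal (loss θ σ (δ z)))
          ∂(samplingLaw p k θ σ)) := by
        refine lintegral_lintegral_swap (Measurable.aemeasurable ?_)
        have h1 : Measurable fun w : (E p × ℝ) × ℝ =>
          ENNReal.ofReal (w.2 ^ ((0 : ℝ) / 2 - 1)) := by fun_prop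
        exact h1.mul (hψ'.mul (hl.comp measurable_fst))
    _ = _ := by
        refine setLIntegral_congr_fun measurableSet_Ioi fun v hv => ?_
        have hv : 0 < v := hv
        have hmv : Measurable fun z : E p × ℝ =>
            ENNReal.ofReal (v * ((‖z.1‖ ^ 2 + z.2) / σ ^ 2) *
              Real.exp (-(v * ((‖z.1‖ ^ 2 + z.2) / σ ^ 2)))) := by fun_prop
        refine (lintegral_const_mul _ (hmv.mul hl)).trans (congrArg _ ?_)
        refine ((lintegral_congr (hinner v hv)).trans ?_).symm
        -- After the change of parameter nothing depends on the direction `ω`, which integrates to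
        -- `1`.
        rw [lintegral_const, measure_univ, mul_one]
        rfl

/-! ### Comparison of risks and the domination criterion. -/

lemma posteriorLoss_le_of_closer (hp : 1 ≤ p) (hk : 1 ≤ k) {m l a b s : ℝ}
    (hl : l < (k : ℝ) + p) (x : E p) (hs : 0 < s)
    (h : x ≠ 0 → |a - hBU p k m l (‖x‖ ^ 2 / s)| ≤ |b - hBU p k m l (‖x‖ ^ 2 / s)|) :
    posteriorLoss p k (boundaryPrior p m l) x s (a • x) ≤
      posteriorLoss p k (boundaryPrior p m l) x s (b • x) := by
  rcases eq_or_ne x 0 with rfl | hx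
  · simp
  obtain ⟨B, C, hB, hC, e⟩ := posteriorLoss_boundaryPrior (m := m) hp hk hl x hs
  rw [e, e, ← sub_smul, ← sub_smul, norm_smul, norm_smul, Real.norm_eq_abs, Real.norm_eq_abs]
  have := h hx
  gcongr

lemma posteriorLoss_lt_of_closer (hp : 1 ≤ p) (hk : 1 ≤ k) {m l a b s : ℝ}
    (hl : l < (k : ℝ) + p) {x : E p} (hs : 0 < s) (hx : x ≠ 0)
    (h : |a - hBU p k m l (‖x‖ ^ 2 / s)| < |b - hBU p k m l (‖x‖ ^ 2 / s)|) :
    posteriorLoss p k (boundaryPrior p m l) x s (a • x) <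
      posteriorLoss p k (boundaryPrior p m l) x s (b • x) := by
  obtain ⟨B, C, hB, hC, e⟩ := posteriorLoss_boundaryPrior (m := m) hp hk hl x hs
  have hx' := norm_pos_iff.2 hx
  have h1 : |a - hBU p k m l (‖x‖ ^ 2 / s)| * ‖x‖ < |b - hBU p k m l (‖x‖ ^ 2 / s)| * ‖x‖ := by
    gcongr
  have h2 : (|a - hBU p k m l (‖x‖ ^ 2 / s)| * ‖x‖) ^ 2 <
      (|b - hBU p k m l (‖x‖ ^ 2 / s)| * ‖x‖) ^ 2 := by gcongr
  rw [e, e, ← sub_smul, ← sub_smul, norm_smul, norm_smul, Real.norm_eq_abs, Real.norm_eq_abs]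
  refine (ENNReal.ofReal_lt_ofReal_iff_of_nonneg (by positivity)).2 ?_
  nlinarith

lemma risk_le_of_closer [NeZero k] (hp : 1 ≤ p) {h₁ h₂ : ℝ → ℝ} (hm₁ : Measurable h₁)
    (hm₂ : Measurable h₂) (θ : E p) {σ : ℝ} (hσ : 0 < σ)
    (h : ∀ t, 0 < t → |h₂ t - hBU p k (‖θ‖ / σ) 0 t| ≤ |h₁ t - hBU p k (‖θ‖ / σ) 0 t|) :
    risk p k θ σ (equivariant p h₂) ≤ risk p k θ σ (equivariant p h₁) := by
  have hk : 1 ≤ k := Nat.one_le_iff_ne_zero.2 (NeZero.ne k)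
  have hS : MeasurableSet {z : E p × ℝ | 0 < z.2} :=
    measurableSet_lt measurable_const measurable_snd
  rw [risk_equivariant_eq hp hm₁ θ hσ, risk_equivariant_eq hp hm₂ θ hσ]
  refine setLIntegral_mono' hS fun z hz => ?_
  have hz : 0 < z.2 := hz
  refine mul_le_mul_right (posteriorLoss_le_of_closer hp hk (by positivity) z.1 hz
    fun hx => h _ ?_) _
  have := norm_pos_iff.2 hx
  positivity

lemma risk_lt_of_closer [NeZero k] (hp : 1 ≤ p) {h₁ h₂ : ℝ → ℝ} (hm₁ : Measurable h₁)
    (hm₂ : Measurable h₂) (θ : E p) {σ : ℝ} (hσ : 0 < σ)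
    (hfin : risk p k θ σ (equivariant p h₂) ≠ ∞)
    (h : ∀ t, 0 < t → |h₂ t - hBU p k (‖θ‖ / σ) 0 t| ≤ |h₁ t - hBU p k (‖θ‖ / σ) 0 t|)
    {t₀ : ℝ} (ht₀ : 0 ≤ t₀)
    (h' : ∀ t, t₀ < t → |h₂ t - hBU p k (‖θ‖ / σ) 0 t| < |h₁ t - hBU p k (‖θ‖ / σ) 0 t|) :
    risk p k θ σ (equivariant p h₂) < risk p k θ σ (equivariant p h₁) := by
  have hk : 1 ≤ k := Nat.one_le_iff_ne_zero.2 (NeZero.ne k)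
  have := sfinite_boundaryPrior hp (‖θ‖ / σ) 0
  have hS : MeasurableSet {z : E p × ℝ | 0 < z.2} :=
    measurableSet_lt measurable_const measurable_snd
  have hw : Measurable fun z : E p × ℝ =>
    ENNReal.ofReal ((‖z.1‖ ^ 2 + z.2) * Real.exp (-(‖z.1‖ ^ 2 + z.2))) := by fun_prop
  -- The event `T > t₀` is open and nonempty, hence of positive Lebesgue measure; a strict gain on
  -- it is strict for the integral because the smaller risk is finite.
  set U : Set (E p × ℝ) := {z | 0 < z.2 ∧ t₀ * z.2 < ‖z.1‖ ^ 2} with hU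
  have hUo : IsOpen U := (isOpen_lt continuous_const continuous_snd).inter
    (isOpen_lt (continuous_const.mul continuous_snd) (continuous_fst.norm.pow 2))
  have hUne : U.Nonempty := by
    refine ⟨(Real.sqrt (t₀ + 1) • EuclideanSpace.single ⟨0, hp⟩ 1, 1), one_pos, ?_⟩
    have : Real.sqrt (t₀ + 1) ^ 2 = t₀ + 1 := Real.sq_sqrt (by linarith)
    simp [norm_smul, this]
  have hUpos : (volume.restrict {z : E p × ℝ | 0 < z.2}) U ≠ 0 := by
    rw [Measure.restrict_apply hUo.measurableSet,
      inter_eq_self_of_subset_left (fun z hz => hz.1)]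
    exact (hUo.measure_pos volume hUne).ne'
  rw [risk_equivariant_eq hp hm₂ θ hσ] at hfin ⊢
  rw [risk_equivariant_eq hp hm₁ θ hσ]
  refine lintegral_strict_mono_of_ae_le_of_ae_lt_on
    (hw.mul (measurable_posteriorLoss (measurable_equivariant hm₁) _)).aemeasurable hfin ?_ hUpos ?_
  · filter_upwards [ae_restrict_mem hS] with z hz
    have hz : 0 < z.2 := hz
    refine mul_le_mul_right (posteriorLoss_le_of_closer hp hk (by positivity) z.1 hz
      fun hx => h _ ?_) _
    have := norm_pos_iff.2 hx
    positivity
  · refine ae_of_all _ fun z hz => ?_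
    obtain ⟨hz, hz'⟩ := hz
    have hpos : 0 < ‖z.1‖ ^ 2 := by
      have : 0 ≤ t₀ * z.2 := by positivity
      linarith
    have hx : z.1 ≠ 0 := fun h => by simp [h] at hpos
    refine ENNReal.mul_lt_mul_right ?_ ENNReal.ofReal_ne_top
      (posteriorLoss_lt_of_closer hp hk (by positivity) hz hx (h' _ ((lt_div_iff₀ hz).2 hz')))
    rw [ENNReal.ofReal_ne_zero_iff]
    positivity

/-- A bounded multiplier has loss at most quadratic in `X`, and Gaussian second moments are finite.
-/
lemma risk_equivariant_ne_top [NeZero k] {h : ℝ → ℝ} (θ : E p) {σ : ℝ}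
    (hσ : 0 < σ) {M : ℝ} (hM : ∀ t, 0 < t → |h t| ≤ M) :
    risk p k θ σ (equivariant p h) ≠ ∞ := by
  have hM0 : 0 ≤ M := (abs_nonneg _).trans (hM 1 one_pos)
  have hi : Integrable (fun z : E p × ℝ => 2 * (M ^ 2 * ‖z.1‖ ^ 2 + ‖θ‖ ^ 2) / σ ^ 2)
      (samplingLaw p k θ σ) := by
    have := isProbabilityMeasure_samplingLaw (k := k) θ hσ
    have h1 : Integrable (fun x : E p => ‖x‖ ^ 2)
        (multivariateGaussian θ (σ ^ 2 • (1 : Matrix (Fin p) (Fin p) ℝ))) :=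
      (IsGaussian.memLp_two_id).integrable_norm_pow (by norm_num)
    have : IsProbabilityMeasure ((chiSq k).map (fun y => σ ^ 2 * y)) :=
      Measure.isProbabilityMeasure_map (by fun_prop)
    have h2 : Integrable (fun z : E p × ℝ => ‖z.1‖ ^ 2) (samplingLaw p k θ σ) := h1.comp_fst _
    exact (((h2.const_mul _).add (integrable_const _)).const_mul 2).div_const _
  refine (lt_of_le_of_lt (lintegral_mono_ae ?_) hi.lintegral_lt_top).ne
  filter_upwards [ae_samplingLaw_pos (p := p) (k := k) θ hσ] with z hz
  apply ENNReal.ofReal_le_ofReal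
  rw [loss]
  have hb : ‖equivariant p h z‖ ≤ M * ‖z.1‖ := by
    rw [equivariant, norm_smul, Real.norm_eq_abs]
    rcases eq_or_ne z.1 0 with h0 | h0
    · simp [h0]
    · have := norm_pos_iff.2 h0
      gcongr
      exact hM _ (by positivity)
  have h1 := norm_sub_le (equivariant p h z) θ
  have h2 : ‖equivariant p h z - θ‖ ^ 2 ≤ (M * ‖z.1‖ + ‖θ‖) ^ 2 := by
    gcongr
    linarith
  gcongr
  nlinarith [sq_nonneg (M * ‖z.1‖ - ‖θ‖)]

lemma hBU_mono_radius (hp : 1 ≤ p) {t : ℝ} (ht : 0 < t) {m m' : ℝ} (hm : 0 ≤ m) (hmm : m ≤ m') :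
    hBU p k m 0 t ≤ hBU p k m' 0 t := by
  rcases hmm.eq_or_lt with rfl | h
  · rfl
  · exact (hBU_strictMono_radius hp ht hm h).le

/-- Shrinking an equivariant estimator towards the boundary uniform estimator with `l = 0` is an
improvement over the whole parameter space. -/
lemma dominates_of_shrink (hp : 1 ≤ p) (hk : 1 ≤ k) {m : ℝ} (hm : 0 < m) {h₁ h₂ : ℝ → ℝ}
    (hm₁ : Measurable h₁) (hm₂ : Measurable h₂) {M : ℝ} (hM : ∀ t, 0 < t → |h₂ t| ≤ M)
    (h : ∀ t, 0 < t → h₂ t = h₁ t ∨ (hBU p k m 0 t ≤ h₂ t ∧ h₂ t < h₁ t)) {t₀ : ℝ} (ht₀ : 0 ≤ t₀)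
    (h' : ∀ t, t₀ < t → h₂ t < h₁ t) {δ₁ δ₂ : E p × ℝ → E p}
    (hδ₁ : ∀ x s, 0 < s → δ₁ (x, s) = equivariant p h₁ (x, s))
    (hδ₂ : ∀ x s, 0 < s → δ₂ (x, s) = equivariant p h₂ (x, s)) :
    Dominates p k m δ₂ δ₁ := by
  have : NeZero k := ⟨by omega⟩
  have key : ∀ c t, 0 ≤ c → c ≤ m → 0 < t →
      |h₂ t - hBU p k c 0 t| ≤ |h₁ t - hBU p k c 0 t| ∧
      (h₂ t < h₁ t → |h₂ t - hBU p k c 0 t| < |h₁ t - hBU p k c 0 t|) := by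
    intro c t hc hcm ht
    rcases h t ht with e | ⟨h1, h2⟩
    · exact ⟨by rw [e], fun hlt => absurd e hlt.ne⟩
    -- Here `h(c, 0, t) ≤ h(m, 0, t) ≤ h₂ t < h₁ t`, so both absolute values open with the same
    -- sign.
    · have := hBU_mono_radius (k := k) hp ht hc hcm
      rw [abs_of_nonneg (by linarith), abs_of_nonneg (by linarith)]
      exact ⟨by linarith, fun _ => by linarith⟩
  -- Strictness is checked at a boundary parameter with `σ = 1` and `‖θ‖ = m`.
  refine ⟨fun q hq => ?_, (m • EuclideanSpace.single ⟨0, hp⟩ 1, 1), ⟨one_pos, ?_⟩, ?_⟩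
  · rw [risk_congr hq.1 hδ₁, risk_congr hq.1 hδ₂]
    exact risk_le_of_closer hp hm₁ hm₂ q.1 hq.1 fun t ht =>
      (key _ t (div_nonneg (norm_nonneg _) hq.1.le) hq.2 ht).1
  · simp [norm_smul, abs_of_pos hm]
  · rw [risk_congr one_pos hδ₁, risk_congr one_pos hδ₂]
    have hn : ‖m • (EuclideanSpace.single ⟨0, hp⟩ 1 : E p)‖ / (1 : ℝ) = m := by
      simp [norm_smul, abs_of_pos hm]
    refine risk_lt_of_closer hp hm₁ hm₂ _ one_pos (risk_equivariant_ne_top _ one_pos hM)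
      ?_ ht₀ ?_
    · rw [hn]
      exact fun t ht => (key m t hm.le le_rfl ht).1
    · rw [hn]
      exact fun t ht => (key m t hm.le le_rfl (ht₀.trans_lt ht)).2 (h' t ht)

lemma hBU_lt_hMLE (hp : 1 ≤ p) {m t : ℝ} (hm : 0 < m) (ht : 0 < t) (h : hBU p k m 0 t < 1) :
    hBU p k m 0 t < hMLE p k m t :=
  lt_min (hBU_lt_mleRoot hp hm ht) h

/-- The threshold is the value of `t` at which `1` solves the quadratic; the right side decreases in
`t`, so beyond it the root is below `1`. This provides the range of `T` on which the truncation is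
inactive. -/
lemma mleRoot_lt_one (hp : 1 ≤ p) {m t : ℝ} (hm : 0 < m) (ht : m ^ 2 / (p + k) < t) :
    mleRoot p k m t < 1 := by
  have hp' : (0 : ℝ) < p := by exact_mod_cast hp
  have ht0 : 0 < t := lt_of_le_of_lt (by positivity) ht
  have hq := mleRoot_quadratic (k := k) hp hm ht0
  by_contra! hge
  have h1 : m ^ 2 < t * (p + k) := (div_lt_iff₀ (by positivity)).1 ht
  have h2 : m ^ 2 * ((1 + t) / t) < p + k + m ^ 2 := by
    rw [mul_div_assoc', div_lt_iff₀ ht0]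
    nlinarith
  nlinarith [mul_le_mul_of_nonneg_left hge (by positivity : 0 ≤ m ^ 2),
    mul_le_mul_of_nonneg_left (one_le_pow₀ hge : 1 ≤ mleRoot p k m t ^ 2)
      (by positivity : (0 : ℝ) ≤ p + k)]

lemma abs_hBU_le (hp : 1 ≤ p) {m l t : ℝ} (hm : 0 < m) (hl : l < (k : ℝ) + p) (ht : 0 < t) :
    |hBU p k m l t| ≤ m ^ 2 / p := by
  rw [abs_of_nonneg (hBU_nonneg hp hl ht)]
  exact (hBU_lt hp hm hl ht).le

lemma abs_hMLE_le {m t : ℝ} (ht : 0 < t) : |hMLE p k m t| ≤ 1 := by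
  rw [abs_of_nonneg (hMLE_nonneg ht.le)]
  exact min_le_right _ _

lemma hMLE_lt_one (hp : 1 ≤ p) {m t : ℝ} (hm : 0 < m) (ht : m ^ 2 / (p + k) < t) :
    hMLE p k m t < 1 :=
  (min_le_left _ _).trans_lt (mleRoot_lt_one hp hm ht)

/-- Serves where `h(m, 0, ·)` need not stay below `1`: it suffices that the truncation is inactive
at `t`. -/
lemma hBU_lt_of_hMLE_lt_one (hp : 1 ≤ p) {m t : ℝ} (hm : 0 < m) (ht : 0 < t)
    (h : hMLE p k m t < 1) : hBU p k m 0 t < hMLE p k m t := by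
  have e : hMLE p k m t = mleRoot p k m t := by
    rw [hMLE_eq] at h ⊢
    exact min_eq_left ((min_lt_iff.1 h).resolve_right (lt_irrefl _)).le
  rw [e]
  exact hBU_lt_mleRoot hp hm ht

lemma unbiased_eq_equivariant (x : E p) (s : ℝ) :
    unbiased p (x, s) = equivariant p (fun _ => 1) (x, s) := by
  simp [unbiased, equivariant]

end BoundedSNR

/-! ### The theorem: each part as an ordering of multipliers. -/

theorem corollary3p1 (p k : ℕ) (hp : 1 ≤ p) (hk : 1 ≤ k) (m : ℝ) (hm : 0 < m) :
    -- the estimators exist, with the multipliers `h_mle` and `h(m, l, ·)`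
    BoundedSNR.IsMLE p k m (BoundedSNR.equivariant p (BoundedSNR.hMLE p k m)) ∧
    (∀ l : ℝ, l < (k : ℝ) + p →
      BoundedSNR.IsBU p k m l (BoundedSNR.equivariant p (BoundedSNR.hBU p k m l))) ∧
    -- (a)
    (((2 ≤ p ∧ 2 ≤ k) ∨ (k = 1 ∧ m ≤ Real.sqrt p)) →
      ∀ δmle, BoundedSNR.IsMLE p k m δmle →
        BoundedSNR.Dominates p k m δmle (BoundedSNR.unbiased p)) ∧
    -- (b)
    (m ≤ Real.sqrt p → (2 ≤ p ∨ (p = 1 ∧ k = 1)) →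
      ∀ δ₀ δmle, BoundedSNR.IsBU p k m 0 δ₀ → BoundedSNR.IsMLE p k m δmle →
        BoundedSNR.Dominates p k m δ₀ δmle) ∧
    -- (c)
    (m ≤ Real.sqrt p → ∀ l : ℝ, 0 ≤ l → l < (k : ℝ) + p →
      ∀ δₗ, BoundedSNR.IsBU p k m l δₗ →
        BoundedSNR.Dominates p k m δₗ (BoundedSNR.unbiased p)) ∧
    -- (d)
    (∀ l : ℝ, 0 < l → l < (k : ℝ) + p →
      ∀ δₗ δ₀, BoundedSNR.IsBU p k m l δₗ → BoundedSNR.IsBU p k m 0 δ₀ →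
        BoundedSNR.Inadmissible p k m δₗ ∧ BoundedSNR.Dominates p k m δ₀ δₗ) ∧
    -- (e)
    (Real.sqrt p < m → 2 ≤ p → 2 ≤ k →
      ∀ δmle, BoundedSNR.IsMLE p k m δmle →
        BoundedSNR.Inadmissible p k m δmle ∧
        BoundedSNR.Dominates p k m
          (BoundedSNR.equivariant p
            (fun t => min (BoundedSNR.hMLE p k m t) (BoundedSNR.hBU p k m 0 t))) δmle) := by
  open BoundedSNR in
  have hl0 : (0 : ℝ) < (k : ℝ) + p := by
    have : (0 : ℝ) < p := by exact_mod_cast hp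
    positivity
  have ht₀ : 0 ≤ m ^ 2 / ((p : ℝ) + k) := by positivity
  -- For `m ≤ √p` the bound `m² / p` on Bayes multipliers is at most `1`, the multiplier of `X` and
  -- the truncation level of `hMLE`.
  have hle : m ≤ Real.sqrt p → m ^ 2 / p ≤ 1 := fun h =>
    div_le_one_of_le₀ ((Real.le_sqrt' hm).1 h) (Nat.cast_nonneg p)
  have hbu_one : m ≤ Real.sqrt p → ∀ l : ℝ, l < (k : ℝ) + p → ∀ t, 0 < t → hBU p k m l t < 1 :=
    fun h l hl t ht => (hBU_lt hp hm hl ht).trans_le (hle h)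
  have hbu_mono : ∀ l : ℝ, 0 ≤ l → l < (k : ℝ) + p → ∀ t, 0 < t →
      hBU p k m 0 t ≤ hBU p k m l t := by
    intro l hl0 hl t ht
    rcases hl0.eq_or_lt with rfl | h
    · rfl
    · exact (hBU_lt_of_pos hp hm h hl ht).le
  refine ⟨isMLE_hMLE hp hk hm, fun l hl => isBU_hBU hp hk hl, ?_, ?_, ?_, ?_, ?_⟩
  · intro _ δ hδ
    refine dominates_of_shrink hp hk hm measurable_const measurable_hMLE
      (fun t ht => abs_hMLE_le ht) (fun t ht => ?_) ht₀ (fun t ht => hMLE_lt_one hp hm ht)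
      (fun x s _ => unbiased_eq_equivariant x s) (fun x s hs => hδ.eq_hMLE hp hk hm x hs)
    rcases (show hMLE p k m t ≤ 1 from min_le_right _ _).eq_or_lt with h | h
    · exact Or.inl h
    · exact Or.inr ⟨(hBU_lt_of_hMLE_lt_one hp hm ht h).le, h⟩
  · intro hmp _ δ₀ δ hδ₀ hδ
    have h t (ht : 0 < t) : hBU p k m 0 t < hMLE p k m t :=
      hBU_lt_hMLE hp hm ht (hbu_one hmp 0 hl0 t ht)
    exact dominates_of_shrink hp hk hm measurable_hMLE (measurable_hBU hp hl0)
      (fun t ht => abs_hBU_le hp hm hl0 ht) (fun t ht => Or.inr ⟨le_rfl, h t ht⟩) le_rfl h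
      (fun x s hs => hδ.eq_hMLE hp hk hm x hs) (fun x s hs => hδ₀.eq_hBU hp hk hl0 x hs)
  · intro hmp l hl hlk δ hδ
    exact dominates_of_shrink hp hk hm measurable_const (measurable_hBU hp hlk)
      (fun t ht => abs_hBU_le hp hm hlk ht)
      (fun t ht => Or.inr ⟨hbu_mono l hl hlk t ht, hbu_one hmp l hlk t ht⟩) le_rfl
      (hbu_one hmp l hlk)
      (fun x s _ => unbiased_eq_equivariant x s) (fun x s hs => hδ.eq_hBU hp hk hlk x hs)
  · intro l hl hlk δ δ₀ hδ hδ₀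
    have h t (ht : 0 < t) : hBU p k m 0 t < hBU p k m l t := hBU_lt_of_pos hp hm hl hlk ht
    -- Stated for every version: inadmissibility requires a measurable dominating estimator,
    -- supplied by the explicit multiplier, whereas a given `δ₀` is only specified where `S² > 0`.
    have key : ∀ δ₀, IsBU p k m 0 δ₀ → Dominates p k m δ₀ δ := fun δ₀ hδ₀ =>
      dominates_of_shrink hp hk hm (measurable_hBU hp hlk) (measurable_hBU hp hl0)
        (fun t ht => abs_hBU_le hp hm hl0 ht) (fun t ht => Or.inr ⟨le_rfl, h t ht⟩) le_rfl h
        (fun x s hs => hδ.eq_hBU hp hk hlk x hs) (fun x s hs => hδ₀.eq_hBU hp hk hl0 x hs)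
    exact ⟨⟨_, measurable_equivariant (measurable_hBU hp hl0), key _ (isBU_hBU hp hk hl0)⟩,
      key _ hδ₀⟩
  · intro _ _ _ δ hδ
    have hmeas : Measurable fun t => min (hMLE p k m t) (hBU p k m 0 t) :=
      measurable_hMLE.min (measurable_hBU hp hl0)
    have key : Dominates p k m
        (equivariant p (fun t => min (hMLE p k m t) (hBU p k m 0 t))) δ := by
      refine dominates_of_shrink hp hk hm measurable_hMLE hmeas (M := 1) (fun t ht => ?_)
        (fun t _ => ?_) ht₀ (fun t ht => ?_)
        (fun x s hs => hδ.eq_hMLE hp hk hm x hs) (fun x s _ => rfl)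
      · rw [abs_of_nonneg (le_min (hMLE_nonneg ht.le) (hBU_nonneg hp hl0 ht))]
        exact (min_le_left _ _).trans (min_le_right _ _)
      · rcases le_or_gt (hMLE p k m t) (hBU p k m 0 t) with h | h
        · exact Or.inl (min_eq_left h)
        · exact Or.inr ⟨(min_eq_right h.le).ge, min_lt_of_right_lt h⟩
      · exact min_lt_of_right_lt
          (hBU_lt_of_hMLE_lt_one hp hm (ht₀.trans_lt ht) (hMLE_lt_one hp hm ht))
    exact ⟨⟨_, measurable_equivariant hmeas, key⟩, key⟩
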